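/- Let $N\ge 2$ be an integer, $s\in(0,1)$, $p\in(1,\infty)$, and let $\Omega\subset\mathbb R^N$ be a bounded domain (nonempty, open, connected) with $C^{1,1}$ boundary, i.e. for every $x_0\in\partial\Omega$ there are $r>0$, a unit vector $e$ and a function $\gamma:e^\perp\to\mathbb R$, differentiable with Lipschitz derivative, such that for $x\in B_r(x_0)$ one has $x\in\Omega$ if and only if $x\cdot e>\gamma(x-(x\cdot e)e)$. Put $\delta(x)=\mathrm{dist}(x,\mathbb R^N\setminus\Omega)$ for $x\in\mathbb R^N$, and $\Omega_\rho=\{x\in\Omega:\delta(x)<\rho\}$ for $\rho>0$. For open $U\subseteq\mathbb R^N$ let $W^{s,p}(U)$ be the set of $u\in L^p(U)$ with $\int_{U\times U}\frac{|u(x)-u(y)|^p}{|x-y|^{N+ps}}\,dx\,dy<\infty$, and let $W^{s,p}_0(U)$ be the set of $\varphi\in W^{s,p}(\mathbb R^N)$ with $\varphi=0$ a.e. in $\mathbb R^N\setminus U$. For bounded open $D$ let $\widetilde W^{s,p}(D)$ be the set of $u\in L^p_{\rm loc}(\mathbb R^N)$ such that $u\in W^{s,p}(U)$ for some open $U\supset\overline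 D$ and $\int_{\mathbb R^N}\frac{|u(x)|^{p-1}}{(1+|x|)^{N+ps}}\,dx<\infty$. **Theorem.** There is $\rho>0$ (depending only on $N,p,s,\Omega$) and $f\in L^\infty(\Omega_\rho)$ such that $(-\Delta)_p^s\,\delta^s=f$ weakly in $\Omega_\rho$; that is, $\delta^s\in\widetilde W^{s,p}(\Omega_\rho)$ and, for every $\varphi\in W^{s,p}_0(\Omega_\rho)$, $$\int_{\mathbb R^N\times\mathbb R^N}\frac{|\delta^s(x)-\delta^s(y)|^{p-2}\big(\delta^s(x)-\delta^s(y)\big)\big(\varphi(x)-\varphi(y)\big)}{|x-y|^{N+ps}}\,dx\,dy=\int_{\Omega_\rho}f(x)\,\varphi(x)\,dx,$$ where both integrals converge absolutely, and where $|a|^{p-2}a$ is read as $0$ for $a=0$. -/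

import Mathlib

open MeasureTheory
open scoped NNReal ENNReal

noncomputable section

namespace FracPLap

/-- The space `ℝ^N` with its Euclidean norm. -/
abbrev E (N : ℕ) : Type := EuclideanSpace ℝ (Fin N)

/-- The class `C^{1,1}`: differentiable with Lipschitz continuous derivative. -/
def IsC11 {F : Type*} [NormedAddCommGroup F] [NormedSpace ℝ F] (γ : F → ℝ) : Prop :=
  Differentiable ℝ γ ∧ ∃ L : ℝ≥0, LipschitzWith L (fderiv ℝ γ)

/-- `Ω` has a `C^{1,1}` boundary: near each boundary point `Ω` is, in the direction of some unit
vector `e`, the strict epigraph of a `C^{1,1}` function `γ` on the hyperplane orthogonal to `e`. -/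
def HasC11Boundary {N : ℕ} (Ω : Set (E N)) : Prop :=
  ∀ x₀ ∈ frontier Ω, ∃ r : ℝ, 0 < r ∧ ∃ e : E N, ‖e‖ = 1 ∧
    ∃ γ : (Submodule.span ℝ {e})ᗮ → ℝ, IsC11 γ ∧
      ∀ x ∈ Metric.ball x₀ r,
        x ∈ Ω ↔ γ ((Submodule.span ℝ {e})ᗮ.orthogonalProjectionOnto x) < inner ℝ e x

/-- `δ_Ω(x) = dist(x, Ωᶜ)`. -/
def delta {N : ℕ} (Ω : Set (E N)) (x : E N) : ℝ := Metric.infDist x Ωᶜ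

/-- `Ω_ρ = {x ∈ Ω : δ_Ω(x) < ρ}`. -/
def nearBoundary {N : ℕ} (Ω : Set (E N)) (ρ : ℝ) : Set (E N) := {x ∈ Ω | delta Ω x < ρ}

/-- The signed power `a^q = |a|^{q-1} a`. -/
def spow (a q : ℝ) : ℝ := |a| ^ (q - 1) * a

/-- `∫_{U × U} |u(x) - u(y)|^p / |x - y|^{N + ps} dx dy`. -/
def gagliardo {N : ℕ} (s p : ℝ) (U : Set (E N)) (u : E N → ℝ) : ℝ≥0∞ :=
  ∫⁻ z in U ×ˢ U, ENNReal.ofReal (|u z.1 - u z.2| ^ p / ‖z.1 - z.2‖ ^ ((N : ℝ) + p * s))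

/-- `u ∈ W^{s,p}(U)`. -/
def MemW {N : ℕ} (s p : ℝ) (U : Set (E N)) (u : E N → ℝ) : Prop :=
  MemLp u (ENNReal.ofReal p) (volume.restrict U) ∧ gagliardo s p U u < ∞

/-- `u ∈ W^{s,p}_0(Ω)`: `u ∈ W^{s,p}(ℝ^N)` and `u = 0` (almost everywhere) in `Ωᶜ`. -/
def MemW0 {N : ℕ} (s p : ℝ) (Ω : Set (E N)) (u : E N → ℝ) : Prop :=
  MemW s p Set.univ u ∧ ∀ᵐ x, x ∉ Ω → u x = 0

/-- `u ∈ W̃^{s,p}(Ω)` for a bounded set `Ω`: `u ∈ L^p_loc(ℝ^N)`, `u ∈ W^{s,p}(U)` for some open `U`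
containing the (compact) closure of `Ω`, and `∫ |u(x)|^{p-1} / (1 + |x|)^{N + ps} dx < ∞`. -/
def MemWtilde {N : ℕ} (s p : ℝ) (Ω : Set (E N)) (u : E N → ℝ) : Prop :=
  (∀ K : Set (E N), IsCompact K → MemLp u (ENNReal.ofReal p) (volume.restrict K)) ∧
  (∃ U : Set (E N), IsOpen U ∧ closure Ω ⊆ U ∧ MemW s p U u) ∧
  ∫⁻ x, ENNReal.ofReal (|u x| ^ (p - 1) / (1 + ‖x‖) ^ ((N : ℝ) + p * s)) < ∞

/-- The integrand `(u(x) - u(y))^{p-1} (φ(x) - φ(y)) / |x - y|^{N + ps}` of the weak form. -/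
def weakIntegrand {N : ℕ} (s p : ℝ) (u φ : E N → ℝ) (z : E N × E N) : ℝ :=
  spow (u z.1 - u z.2) (p - 1) * (φ z.1 - φ z.2) / ‖z.1 - z.2‖ ^ ((N : ℝ) + p * s)

/-- `u` is a weak solution of `(-Δ)_p^s u = f` in the bounded set `Ω`, where the function `f` acts
on test functions by `φ ↦ ∫_Ω f φ`. The absolute convergence of both integrals is part of the
definition. -/
def IsWeakSolution {N : ℕ} (s p : ℝ) (Ω : Set (E N)) (u f : E N → ℝ) : Prop :=
  MemWtilde s p Ω u ∧
  ∀ φ : E N → ℝ, MemW0 s p Ω φ →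
    Integrable (weakIntegrand s p u φ) ∧ IntegrableOn (fun x => f x * φ x) Ω ∧
      ∫ z, weakIntegrand s p u φ z = ∫ x in Ω, f x * φ x

end FracPLap

end

/-!
Fix `x` near the boundary and let `d = δ(x)`. A bounded `C^{1,1}` domain satisfies a uniform
two-ball condition, so near `x` the signed distance straightens the boundary, with an error
`O(‖y - x‖ ^ 2)` and a Jacobian `1 + O(‖y - x‖)`. In the flattened coordinates the kernel of the
fractional `p`-Laplacian differs from its half-space counterpart by a factor `1 + O(‖y - x‖)`, and
integrating out the tangential variables reduces the half-space operator to a one-dimensional one.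

The principal value is taken along the relative cut-off that keeps a pair of heights `a`, `b` only
if `b ≤ κ a` or `a ≤ κ b`. This cut-off is symmetric, so the truncated operator may be tested
against `φ`, and homogeneous, so the one-dimensional operator takes `t_+ ^ s` at `d` to an explicit
multiple of `d ^ (-s)`, which tends to `0` as `κ → 1`. What remains is the comparison error, bounded
uniformly in `d` and `κ`; twice its limit is `f`. Hardy's inequality for test functions makes
`d ^ (-s) |φ|` integrable, and hence justifies passing to the limit `κ → 1` in the weak form.
-/

noncomputable section

namespace FracPLap

open Filter Metric Set
open scoped Topology

section SignedDistance

/-- The signed distance to the boundary of `S`, positive inside `S`. -/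
def sdist {X : Type*} [PseudoMetricSpace X] (S : Set X) (x : X) : ℝ := infDist x Sᶜ - infDist x S

section Metric

variable {X : Type*} [PseudoMetricSpace X] {S : Set X} {x : X}

lemma sdist_compl (S : Set X) (x : X) : sdist Sᶜ x = -sdist S x := by
  simp [sdist]

lemma sdist_of_mem (hx : x ∈ S) : sdist S x = infDist x Sᶜ := by
  simp [sdist, infDist_zero_of_mem hx]

lemma sdist_of_notMem (hx : x ∉ S) : sdist S x = -infDist x S := by
  simp [sdist, infDist_zero_of_mem (mem_compl hx)]

lemma max_sdist_zero (S : Set X) (x : X) : max (sdist S x) 0 = infDist x Sᶜ := by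
  by_cases hx : x ∈ S
  · rw [sdist_of_mem hx, max_eq_left infDist_nonneg]
  · rw [sdist_of_notMem hx, infDist_zero_of_mem (mem_compl hx), max_eq_right]
    exact neg_nonpos.2 infDist_nonneg

lemma lipschitzWith_sdist (S : Set X) : LipschitzWith 2 (sdist S) := by
  have h := (lipschitz_infDist_pt Sᶜ).sub (lipschitz_infDist_pt S)
  rwa [one_add_one_eq_two] at h

end Metric

section Normed

variable {V : Type*} [NormedAddCommGroup V] [NormedSpace ℝ V] {S : Set V} {c : V} {R : ℝ}

lemma infDist_add_le_dist_of_ball_subset (hR : 0 < R) (hc : ball c R ⊆ S) {y : V}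
    (hy : R ≤ dist c y) : infDist y S + R ≤ dist c y := by
  have hpos : 0 < dist c y := hR.trans_le hy
  set w := AffineMap.lineMap c y (R / dist c y) with hw
  have hwS : w ∈ closure S := by
    refine closure_mono hc ?_
    rw [closure_ball c hR.ne', mem_closedBall, hw, dist_lineMap_left,
      Real.norm_of_nonneg (by positivity), div_mul_cancel₀ _ hpos.ne']
  have hyw : dist y w = dist c y - R := by
    rw [dist_comm, hw, dist_lineMap_right, Real.norm_of_nonneg
      (sub_nonneg.2 ((div_le_one hpos).2 hy)), sub_mul, one_mul, div_mul_cancel₀ _ hpos.ne']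
  have := infDist_le_dist_of_mem (x := y) hwS
  rw [infDist_closure] at this
  linarith

lemma sub_dist_le_sdist (hR : 0 < R) (hc : ball c R ⊆ S) (hS : Sᶜ.Nonempty) (y : V) :
    R - dist c y ≤ sdist S y := by
  by_cases hy : y ∈ S
  · rw [sdist_of_mem hy, le_infDist hS]
    intro w hw
    have hRw : R ≤ dist w c := not_lt.1 fun h => hw (hc h)
    linarith [dist_triangle c y w, dist_comm w c]
  · have hRy : R ≤ dist y c := not_lt.1 fun h => hy (hc h)
    rw [sdist_of_notMem hy]
    linarith [infDist_add_le_dist_of_ball_subset hR hc (hRy.trans_eq (dist_comm y c))]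

lemma sdist_le_dist_sub (hR : 0 < R) (hc : ball c R ⊆ Sᶜ) (hS : S.Nonempty) (y : V) :
    sdist S y ≤ dist c y - R := by
  have := sub_dist_le_sdist hR hc (by simpa using hS) y
  rw [sdist_compl] at this
  linarith

end Normed

end SignedDistance

section TwoBalls

variable {V : Type*} [NormedAddCommGroup V] [InnerProductSpace ℝ V] {R : ℝ} {S : Set V} {x n : V}

/-- Two balls of radius `R`, one inside `S` and one outside, touch each other at `z`. -/
def TwoBallAt (R : ℝ) (S : Set V) (z : V) : Prop :=
  ∃ n : V, ‖n‖ = 1 ∧ ball (z + R • n) R ⊆ S ∧ ball (z - R • n) R ⊆ Sᶜ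

/-- The uniform two-sided ball condition of radius `R`. -/
def TwoBall (R : ℝ) (S : Set V) : Prop := ∀ z ∈ frontier S, TwoBallAt R S z

lemma TwoBall.compl (hT : TwoBall R S) : TwoBall R Sᶜ := by
  intro z hz
  rw [frontier_compl] at hz
  obtain ⟨n, hn, hin, hout⟩ := hT z hz
  exact ⟨-n, by simpa using hn, by simpa [sub_eq_add_neg] using hout, by simpa using hin⟩

lemma TwoBallAt.mono {R' : ℝ} {z : V} (h : TwoBallAt R S z) (hR : R' ≤ R) : TwoBallAt R' S z := by
  obtain ⟨n, hn, hin, hout⟩ := h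
  have hcenters : ‖(R' - R) • n‖ = R - R' := by
    rw [norm_smul, hn, mul_one, Real.norm_of_nonpos (by linarith), neg_sub]
  refine ⟨n, hn, (ball_subset_ball' ?_).trans hin, (ball_subset_ball' ?_).trans hout⟩
  · rw [dist_add_left, dist_eq_norm, ← sub_smul, hcenters, add_sub_cancel]
  · rw [dist_sub_left, dist_eq_norm, ← sub_smul, hcenters, add_sub_cancel]

/-- `n` is the gradient at `x` of a function `D` with second order remainder of size `1 / R`. -/
def HasQuadraticExpansionAt (D : V → ℝ) (R : ℝ) (x n : V) : Prop :=
  ∀ y, |D y - D x - inner ℝ n (y - x)| ≤ ‖y - x‖ ^ 2 / R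

lemma HasQuadraticExpansionAt.hasFDerivAt {D : V → ℝ} (hx : HasQuadraticExpansionAt D R x n) :
    HasFDerivAt D (innerSL ℝ n) x := by
  rw [hasFDerivAt_iff_isLittleO]
  refine Asymptotics.IsBigO.trans_isLittleO (g := fun y => ‖y - x‖ ^ 2) ?_
    (Asymptotics.isLittleO_pow_sub_sub x one_lt_two)
  refine Asymptotics.IsBigO.of_bound R⁻¹ (Eventually.of_forall fun y => ?_)
  rw [Real.norm_eq_abs, innerSL_apply_apply, norm_pow, norm_norm, inv_mul_eq_div]
  exact hx y

/-- Expanding `D` at `x` and at `y` towards `y + e`, where `‖e‖ = ‖y - x‖`, compares the gradients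
in the direction `e`. -/
lemma HasQuadraticExpansionAt.norm_sub_le {D : V → ℝ} (hR : 0 < R) {y m : V}
    (hx : HasQuadraticExpansionAt D R x n) (hy : HasQuadraticExpansionAt D R y m) :
    ‖m - n‖ ≤ 6 / R * ‖y - x‖ := by
  rcases eq_or_ne y x with rfl | hyx
  · have hmn : m = n := by
      rw [← sub_eq_zero, ← norm_eq_zero, ← innerSL_apply_norm (𝕜 := ℝ), map_sub,
        hy.hasFDerivAt.unique hx.hasFDerivAt, sub_self, norm_zero]
    simp [hmn]
  rcases eq_or_ne m n with rfl | hmn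
  · rw [sub_self, norm_zero]
    positivity
  have hr : 0 < ‖y - x‖ := norm_sub_pos_iff.2 hyx
  have hmn : 0 < ‖m - n‖ := norm_sub_pos_iff.2 hmn
  set e : V := (‖y - x‖ / ‖m - n‖) • (m - n) with he
  have hen : ‖e‖ = ‖y - x‖ := by
    rw [he, norm_smul, Real.norm_of_nonneg (by positivity), div_mul_cancel₀ _ hmn.ne']
  have hinner : inner ℝ m e - inner ℝ n e = ‖y - x‖ * ‖m - n‖ := by
    rw [← inner_sub_left, he, inner_smul_right, real_inner_self_eq_norm_sq]
    field_simp
  have hxe := abs_le.1 (hx (y + e))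
  have hye := abs_le.1 (hy (y + e))
  have hxy := abs_le.1 (hx y)
  rw [show y + e - x = (y - x) + e by abel, inner_add_right] at hxe
  rw [add_sub_cancel_left, hen] at hye
  have hfar : ‖(y - x) + e‖ ^ 2 / R ≤ (2 * ‖y - x‖) ^ 2 / R := by
    gcongr
    linarith [norm_add_le (y - x) e]
  have hsum : (2 * ‖y - x‖) ^ 2 / R + ‖y - x‖ ^ 2 / R + ‖y - x‖ ^ 2 / R =
      ‖y - x‖ * (6 / R * ‖y - x‖) := by ring
  refine le_of_mul_le_mul_left ?_ hr
  linarith [hxe.1, hxe.2, hye.1, hye.2, hxy.1, hxy.2]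

/-- `n` is a unit normal at `x` to the level set of the signed distance to the boundary of `S`
through `x`. -/
structure IsUnitNormalAt (S : Set V) (R : ℝ) (x n : V) : Prop where
  norm_eq_one : ‖n‖ = 1
  expansion : HasQuadraticExpansionAt (sdist S) R x n

lemma IsUnitNormalAt.of_compl (h : IsUnitNormalAt Sᶜ R x n) : IsUnitNormalAt S R x (-n) := by
  refine ⟨by simpa using h.norm_eq_one, fun y => ?_⟩
  have := h.expansion y
  rw [sdist_compl, sdist_compl, ← abs_neg] at this
  convert this using 2
  rw [inner_neg_left]
  ring

lemma norm_add_smul_le {v : V} {A : ℝ} (hn : ‖n‖ = 1) (hR : 0 < R) (hA : R ≤ 2 * A) :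
    ‖v + A • n‖ ≤ A + inner ℝ n v + ‖v‖ ^ 2 / R := by
  have hA0 : 0 < 2 * A := hR.trans_le hA
  have hsq : ‖v + A • n‖ ^ 2 = ‖v‖ ^ 2 + 2 * (A * inner ℝ n v) + A ^ 2 := by
    rw [norm_add_sq_real, norm_smul, hn, mul_one, Real.norm_eq_abs, sq_abs, inner_smul_right,
      real_inner_comm]
  have h2A : ‖v + A • n‖ ≤ A + inner ℝ n v + ‖v‖ ^ 2 / (2 * A) := by
    refine le_of_mul_le_mul_left ?_ hA0
    rw [mul_add, mul_div_cancel₀ _ hA0.ne']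
    nlinarith [sq_nonneg (‖v + A • n‖ - A)]
  have : ‖v‖ ^ 2 / (2 * A) ≤ ‖v‖ ^ 2 / R := by gcongr
  linarith

lemma isUnitNormalAt_of_balls (hn : ‖n‖ = 1) {d : ℝ} (hd0 : 0 ≤ d) (hdR : d < R / 2)
    (hx : sdist S x = d) (hin : ball (x + (R - d) • n) R ⊆ S)
    (hout : ball (x - (R + d) • n) R ⊆ Sᶜ) : IsUnitNormalAt S R x n := by
  have hR : 0 < R := by linarith
  refine ⟨hn, fun y => ?_⟩
  have hlo := sub_dist_le_sdist hR hin ⟨_, hout (mem_ball_self hR)⟩ y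
  have hhi := sdist_le_dist_sub hR hout ⟨_, hin (mem_ball_self hR)⟩ y
  have hlo' := norm_add_smul_le (v := y - x) (A := R - d) (n := -n) (by rwa [norm_neg]) hR
    (by linarith)
  have hhi' := norm_add_smul_le (v := y - x) (A := R + d) hn hR (by linarith)
  rw [dist_comm, dist_eq_norm, show y - (x + (R - d) • n) = y - x + (R - d) • -n by module] at hlo
  rw [dist_comm, dist_eq_norm, show y - (x - (R + d) • n) = y - x + (R + d) • n by module] at hhi
  rw [inner_neg_left] at hlo'
  rw [hx, abs_le]
  constructor <;> linarith

lemma eq_add_smul_of_norm_add_le {w : V} (hn : ‖n‖ = 1) (hR : 0 < R)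
    (h : ‖w‖ + R ≤ ‖w + R • n‖) : w = ‖w‖ • n := by
  have hRn : ‖R • n‖ = R := by rw [norm_smul, hn, mul_one, Real.norm_of_nonneg hR.le]
  have hray : SameRay ℝ w (R • n) :=
    sameRay_iff_norm_add.2 ((norm_add_le _ _).antisymm (by rwa [hRn]))
  have := hray.norm_smul_eq
  rw [hRn, smul_comm] at this
  exact (smul_right_injective V hR.ne' this).symm

variable [FiniteDimensional ℝ V]

lemma TwoBall.exists_isUnitNormalAt_of_mem (hT : TwoBall R S) (hR : 0 < R) (hS : S ≠ univ)
    (hx : x ∈ S) (hxR : sdist S x < R / 2) : ∃ n, IsUnitNormalAt S R x n := by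
  obtain ⟨z, hz, hzd⟩ := exists_mem_frontier_infDist_compl_eq_dist hx hS
  obtain ⟨n, hn, hin, hout⟩ := hT z hz
  set d := infDist x Sᶜ with hd
  have hd0 : 0 ≤ d := infDist_nonneg
  rw [dist_eq_norm] at hzd
  have hxz : x - z = d • n := by
    rcases hd0.eq_or_lt with h0 | h0
    · rwa [← h0, zero_smul, ← norm_eq_zero, ← hzd, eq_comm]
    · have hdisj : Disjoint (ball x d) (ball (z - R • n) R) :=
        (disjoint_compl_right (a := S)).mono ball_infDist_compl_subset hout
      rw [disjoint_ball_ball_iff h0 hR, dist_eq_norm, hzd, ← sub_add] at hdisj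
      rw [hzd]
      exact eq_add_smul_of_norm_add_le hn hR hdisj
  rw [sub_eq_iff_eq_add] at hxz
  have hxd : sdist S x = d := sdist_of_mem hx
  refine ⟨n, isUnitNormalAt_of_balls hn hd0 (by rwa [← hxd]) hxd ?_ ?_⟩
  · convert hin using 2
    rw [hxz]
    module
  · convert hout using 2
    rw [hxz]
    module

lemma TwoBall.exists_isUnitNormalAt (hT : TwoBall R S) (hR : 0 < R) (hS : S.Nonempty)
    (hS' : Sᶜ.Nonempty) (hxR : |sdist S x| < R / 2) : ∃ n, IsUnitNormalAt S R x n := by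
  rw [abs_lt] at hxR
  by_cases hx : x ∈ S
  · exact hT.exists_isUnitNormalAt_of_mem hR (nonempty_compl.1 hS') hx hxR.2
  · obtain ⟨n, hn⟩ := hT.compl.exists_isUnitNormalAt_of_mem hR
      (by rwa [Ne, compl_univ_iff, ← Ne, ← nonempty_iff_ne_empty]) (mem_compl hx)
      (by rw [sdist_compl]; linarith)
    exact ⟨-n, hn.of_compl⟩

end TwoBalls

section EpigraphBalls

lemma norm_sub_sub_fderiv_le {F G : Type*} [NormedAddCommGroup F] [NormedSpace ℝ F]
    [NormedAddCommGroup G] [NormedSpace ℝ G] {γ : F → G} (hγ : Differentiable ℝ γ) {L : ℝ≥0}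
    (hL : LipschitzWith L (fderiv ℝ γ)) (a b : F) :
    ‖γ b - γ a - fderiv ℝ γ a (b - a)‖ ≤ L * ‖b - a‖ ^ 2 := by
  rw [sq, ← mul_assoc]
  refine (convex_closedBall a ‖b - a‖).norm_image_sub_le_of_norm_hasFDerivWithin_le'
    (f' := fderiv ℝ γ) (fun x _ => (hγ x).hasFDerivAt.hasFDerivWithinAt) (fun x hx => ?_)
    (mem_closedBall_self (norm_nonneg _)) (by rw [mem_closedBall, dist_eq_norm])
  rw [← dist_eq_norm]
  exact (hL.dist_le_mul x a).trans (by gcongr; exact hx)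

lemma eq_zero_of_mem_frontier {X : Type*} [TopologicalSpace X] {S : Set X} {D : X → ℝ} {z : X}
    (hS : IsOpen S) (hD : ContinuousAt D z) (hSD : ∀ᶠ y in 𝓝 z, y ∈ S ↔ 0 < D y)
    (hz : z ∈ frontier S) : D z = 0 := by
  rw [hS.frontier_eq] at hz
  refine le_antisymm (not_lt.1 fun h => hz.2 (hSD.self_of_nhds.2 h)) (not_lt.1 fun h => ?_)
  obtain ⟨y, hyS, hyD, hy⟩ := ((mem_closure_iff_frequently.1 hz.1).and_eventually
    ((hD.eventually_lt continuousAt_const h).and hSD)).exists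
  exact hyD.not_gt (hy.1 hyS)

variable {V : Type*} [NormedAddCommGroup V] [InnerProductSpace ℝ V] {S : Set V} {R : ℝ} {z n : V}

lemma norm_sub_sq_lt_of_mem_ball (hn : ‖n‖ = 1) (hR : 0 < R) {y : V} (hy : y ∈ ball (z + R • n) R) :
    ‖y - z‖ ^ 2 < 2 * R * inner ℝ n (y - z) := by
  have hRn : ‖R • n‖ = R := by rw [norm_smul, hn, mul_one, Real.norm_of_nonneg hR.le]
  rw [mem_ball, dist_eq_norm, ← sub_sub] at hy
  have hsq : ‖y - z - R • n‖ ^ 2 < R ^ 2 := by gcongr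
  rw [norm_sub_sq_real, hRn, inner_smul_right, real_inner_comm] at hsq
  linarith

lemma HasQuadraticExpansionAt.twoBallAt {D : V → ℝ} {ρ : ℝ} {m : V}
    (hD : HasQuadraticExpansionAt D ρ z m) (hρ : 0 < ρ) (hz : D z = 0) (hR : 0 < R)
    (hRm : 2 * R ≤ ρ * ‖m‖) (hS : ∀ y ∈ ball z (2 * R), y ∈ S ↔ 0 < D y) : TwoBallAt R S z := by
  have hm : 0 < ‖m‖ := pos_of_mul_pos_right (by linarith) hρ.le
  set n := ‖m‖⁻¹ • m with hn_def
  have hn : ‖n‖ = 1 := by rw [hn_def, norm_smul, norm_inv, norm_norm, inv_mul_cancel₀ hm.ne']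
  have hmn : m = ‖m‖ • n := (smul_inv_smul₀ hm.ne' m).symm
  have hball : ∀ σ : V, ‖σ‖ = 1 → ball (z + R • σ) R ⊆ ball z (2 * R) := fun σ hσ =>
    ball_subset_ball' (by
      rw [dist_self_add_left, norm_smul, hσ, mul_one, Real.norm_of_nonneg hR.le, two_mul])
  have hbound : ∀ y, ∀ t : ℝ, ‖y - z‖ ^ 2 < 2 * R * t → ‖y - z‖ ^ 2 / ρ < ‖m‖ * t := by
    intro y t ht
    have ht0 : 0 < t := pos_of_mul_pos_right ((sq_nonneg _).trans_lt ht) (by positivity)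
    rw [div_lt_iff₀ hρ]
    calc _ < 2 * R * t := ht
      _ ≤ ρ * ‖m‖ * t := by gcongr
      _ = _ := by ring
  have hinner : ∀ y, inner ℝ m (y - z) = ‖m‖ * inner ℝ n (y - z) := fun y => by
    nth_rewrite 1 [hmn]
    exact real_inner_smul_left _ _ _
  refine ⟨n, hn, fun y hy => ?_, fun y hy => ?_⟩
  · have hlt := hbound y _ (norm_sub_sq_lt_of_mem_ball hn hR hy)
    have hDy := (abs_le.1 (hD y)).1
    rw [hS y (hball n hn hy)]
    linarith [hinner y]
  · have hn' : ‖-n‖ = 1 := by rwa [norm_neg]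
    rw [sub_eq_add_neg, ← smul_neg] at hy
    have hlt := hbound y _ (norm_sub_sq_lt_of_mem_ball hn' hR hy)
    have hDy := (abs_le.1 (hD y)).2
    rw [inner_neg_left, mul_neg] at hlt
    rw [mem_compl_iff, hS y (hball (-n) hn' hy), not_lt]
    linarith [hinner y]

variable {K : Submodule ℝ V} [CompleteSpace K] {γ : K → ℝ} {L : ℝ≥0}

lemma hasQuadraticExpansionAt_epigraph (hγ : Differentiable ℝ γ)
    (hL : LipschitzWith L (fderiv ℝ γ)) (e z : V) :
    ∃ g ∈ K, HasQuadraticExpansionAt (fun x => inner ℝ e x - γ (K.orthogonalProjectionOnto x))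
      (L + 1 : ℝ)⁻¹ z (e - g) := by
  set P := K.orthogonalProjectionOnto
  set g : K := (InnerProductSpace.toDual ℝ K).symm (fderiv ℝ γ (P z)) with hg
  have hgP : ∀ w, fderiv ℝ γ (P z) (P w) = inner ℝ (g : V) w := by
    intro w
    rw [← Submodule.inner_orthogonalProjectionOnto_eq_of_mem_left, hg,
      InnerProductSpace.toDual_symm_apply]
  refine ⟨g, g.2, fun y => ?_⟩
  have hTaylor := norm_sub_sub_fderiv_le hγ hL (P z) (P y)
  rw [← map_sub, hgP, Real.norm_eq_abs, ← abs_neg] at hTaylor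
  calc _ = |-(γ (P y) - γ (P z) - inner ℝ (g : V) (y - z))| := by
        congr 1
        rw [inner_sub_left, inner_sub_right e]
        ring
    _ ≤ L * ‖P (y - z)‖ ^ 2 := hTaylor
    _ ≤ (L + 1) * ‖y - z‖ ^ 2 := by
        gcongr
        · exact le_add_of_nonneg_right zero_le_one
        · exact K.norm_orthogonalProjectionOnto_apply_le _
    _ = _ := by rw [div_inv_eq_mul, mul_comm]

lemma twoBallAt_of_epigraph (hS : IsOpen S) {x₀ e : V} {r : ℝ} (hr : 0 < r) (he : ‖e‖ = 1)
    (hK : ∀ k ∈ K, inner ℝ e k = 0) (hγ : Differentiable ℝ γ) (hL : LipschitzWith L (fderiv ℝ γ))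
    (hγS : ∀ x ∈ ball x₀ r, x ∈ S ↔ γ (K.orthogonalProjectionOnto x) < inner ℝ e x)
    (hz : z ∈ frontier S) (hzr : z ∈ ball x₀ (r / 2)) :
    TwoBallAt (min (r / 4) ((L + 1 : ℝ)⁻¹ / 2)) S z := by
  obtain ⟨g, hgK, hD⟩ := hasQuadraticExpansionAt_epigraph hγ hL e z
  have hm : 1 ≤ ‖e - g‖ := by
    have := real_inner_le_norm e (e - g)
    rwa [inner_sub_right, hK g hgK, real_inner_self_eq_norm_sq, he, one_pow, sub_zero,
      one_mul] at this
  have hball : ball z (r / 2) ⊆ ball x₀ r := by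
    refine ball_subset_ball' ?_
    rw [mem_ball] at hzr
    linarith
  have hDS : ∀ y ∈ ball z (r / 2),
      y ∈ S ↔ 0 < inner ℝ e y - γ (K.orthogonalProjectionOnto y) := fun y hy =>
    (hγS y (hball hy)).trans sub_pos.symm
  refine hD.twoBallAt (by positivity) ?_ (by positivity) ?_ fun y hy =>
    hDS y (ball_subset_ball ?_ hy)
  · refine eq_zero_of_mem_frontier (D := fun x => inner ℝ e x - γ (K.orthogonalProjectionOnto x))
      hS hD.hasFDerivAt.continuousAt ?_ hz
    filter_upwards [ball_mem_nhds z (half_pos hr)] using hDS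
  · have hρ : (0 : ℝ) ≤ (L + 1 : ℝ)⁻¹ := by positivity
    linarith [min_le_right (r / 4) ((L + 1 : ℝ)⁻¹ / 2), le_mul_of_one_le_right hρ hm]
  · linarith [min_le_left (r / 4) ((L + 1 : ℝ)⁻¹ / 2)]

lemma exists_twoBall_of_forall_nhds (hc : IsCompact (frontier S))
    (h : ∀ x ∈ frontier S, ∃ R, 0 < R ∧ ∀ᶠ z in 𝓝 x, z ∈ frontier S → TwoBallAt R S z) :
    ∃ R, 0 < R ∧ TwoBall R S := by
  suffices h : ∃ R, 0 < R ∧ ∀ z ∈ frontier S, z ∈ frontier S → TwoBallAt R S z by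
    obtain ⟨R, hR, h⟩ := h
    exact ⟨R, hR, fun z hz => h z hz hz⟩
  refine hc.induction_on
    (p := fun T => ∃ R, 0 < R ∧ ∀ z ∈ T, z ∈ frontier S → TwoBallAt R S z) ?_ ?_ ?_ ?_
  · exact ⟨1, one_pos, by simp⟩
  · rintro T T' hTT' ⟨R, hR, h⟩
    exact ⟨R, hR, fun z hz => h z (hTT' hz)⟩
  · rintro T T' ⟨R, hR, h⟩ ⟨R', hR', h'⟩
    refine ⟨min R R', lt_min hR hR', ?_⟩
    rintro z (hz | hz) hzS
    · exact (h z hz hzS).mono (min_le_left _ _)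
    · exact (h' z hz hzS).mono (min_le_right _ _)
  · intro x hx
    obtain ⟨R, hR, h⟩ := h x hx
    exact ⟨_, mem_nhdsWithin_of_mem_nhds h, R, hR, fun z hz => hz⟩

lemma HasC11Boundary.exists_twoBall {N : ℕ} {Ω : Set (E N)} (hΩ : HasC11Boundary Ω)
    (ho : IsOpen Ω) (hb : Bornology.IsBounded Ω) : ∃ R, 0 < R ∧ TwoBall R Ω := by
  refine exists_twoBall_of_forall_nhds
    (hb.isCompact_closure.of_isClosed_subset isClosed_frontier frontier_subset_closure) ?_
  intro x₀ hx₀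
  obtain ⟨r, hr, e, he, γ, ⟨hγ, L, hL⟩, hγΩ⟩ := hΩ x₀ hx₀
  refine ⟨min (r / 4) ((L + 1 : ℝ)⁻¹ / 2), by positivity, ?_⟩
  filter_upwards [ball_mem_nhds x₀ (half_pos hr)] with z hzr hz
  exact twoBallAt_of_epigraph ho hr he
    (fun k hk => Submodule.mem_orthogonal_singleton_iff_inner_right.1 hk) hγ hL hγΩ hz hzr

end EpigraphBalls

section Straightening

variable {V : Type*} [NormedAddCommGroup V] [InnerProductSpace ℝ V] {S : Set V} {R : ℝ} {x n y : V}

/-- A modification of the identity along the normal `n` at `x` which takes the signed distance of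
`S` to an affine function. -/
def flatten (S : Set V) (x n y : V) : V := y + (sdist S y - sdist S x - inner ℝ n (y - x)) • n

/-- `n` is a unit normal at `x` and there are unit normals at all points near `x`, so that
`flatten S x n` is a change of variables there. -/
structure IsTubularNormal (S : Set V) (R : ℝ) (x n : V) : Prop extends IsUnitNormalAt S R x n where
  radius_pos : 0 < R
  exists_isUnitNormalAt : ∀ y ∈ ball x (R / 24), ∃ m, IsUnitNormalAt S R y m

lemma TwoBall.exists_isTubularNormal [FiniteDimensional ℝ V] (hT : TwoBall R S) (hR : 0 < R)
    (hS : S.Nonempty) (hS' : Sᶜ.Nonempty) (hx : |sdist S x| < R / 24) :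
    ∃ n, IsTubularNormal S R x n := by
  obtain ⟨n, hn⟩ := hT.exists_isUnitNormalAt hR hS hS' (hx.trans (by linarith))
  refine ⟨n, hn, hR, fun y hy => hT.exists_isUnitNormalAt hR hS hS' ?_⟩
  have hyx := (lipschitzWith_sdist S).dist_le_mul y x
  rw [Real.dist_eq, NNReal.coe_ofNat] at hyx
  linarith [abs_sub_abs_le_abs_sub (sdist S y) (sdist S x), mem_ball.1 hy]

lemma flatten_self (S : Set V) (x n : V) : flatten S x n x = x := by
  simp [flatten]

namespace IsUnitNormalAt

lemma sdist_eq_flatten (hx : IsUnitNormalAt S R x n) (y : V) :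
    sdist S y = sdist S x + inner ℝ n (flatten S x n y - x) := by
  have hnn : inner ℝ n n = 1 := by rw [real_inner_self_eq_norm_sq, hx.norm_eq_one, one_pow]
  rw [flatten, add_sub_right_comm, inner_add_right, inner_smul_right, hnn]
  ring

lemma norm_flatten_sub_le (hx : IsUnitNormalAt S R x n) (y : V) :
    ‖flatten S x n y - y‖ ≤ ‖y - x‖ ^ 2 / R := by
  rw [flatten, add_sub_cancel_left, norm_smul, hx.norm_eq_one, mul_one]
  exact hx.expansion y

lemma hasFDerivAt_flatten {m : V} (hy : IsUnitNormalAt S R y m) :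
    HasFDerivAt (flatten S x n)
      (ContinuousLinearMap.id ℝ V + (innerSL ℝ (m - n)).smulRight n) y := by
  rw [map_sub]
  exact (hasFDerivAt_id y).add (((hy.expansion.hasFDerivAt.sub_const (sdist S x)).sub
    ((innerSL ℝ n).hasFDerivAt.comp y ((hasFDerivAt_id y).sub_const x))).smul_const n)

end IsUnitNormalAt

namespace IsTubularNormal

lemma differentiableAt_flatten (hx : IsTubularNormal S R x n) (hy : y ∈ ball x (R / 24)) :
    DifferentiableAt ℝ (flatten S x n) y := by
  obtain ⟨m, hm⟩ := hx.exists_isUnitNormalAt y hy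
  exact hm.hasFDerivAt_flatten.differentiableAt

lemma norm_fderiv_flatten_sub_id_le (hx : IsTubularNormal S R x n) (hy : y ∈ ball x (R / 24)) :
    ‖fderiv ℝ (flatten S x n) y - ContinuousLinearMap.id ℝ V‖ ≤ 1 / 4 := by
  obtain ⟨m, hm⟩ := hx.exists_isUnitNormalAt y hy
  have hR := hx.radius_pos
  rw [hm.hasFDerivAt_flatten.fderiv, add_sub_cancel_left,
    ContinuousLinearMap.norm_smulRight_apply, hx.norm_eq_one, mul_one, innerSL_apply_norm]
  calc ‖m - n‖ ≤ 6 / R * ‖y - x‖ := hx.expansion.norm_sub_le hR hm.expansion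
    _ ≤ 6 / R * (R / 24) := by gcongr; exact (mem_ball_iff_norm.1 hy).le
    _ = 1 / 4 := by field_simp; norm_num

lemma abs_det_fderiv_flatten_sub_one_le [FiniteDimensional ℝ V] (hx : IsTubularNormal S R x n)
    (hy : y ∈ ball x (R / 24)) :
    |(fderiv ℝ (flatten S x n) y).det - 1| ≤ 6 / R * ‖y - x‖ := by
  obtain ⟨m, hm⟩ := hx.exists_isUnitNormalAt y hy
  have hdet : (fderiv ℝ (flatten S x n) y).det = 1 + inner ℝ (m - n) n := by
    rw [hm.hasFDerivAt_flatten.fderiv]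
    exact LinearMap.transvection.det (innerSL ℝ (m - n) : V →ₗ[ℝ] ℝ) n
  rw [hdet, add_sub_cancel_left]
  calc _ ≤ ‖m - n‖ * ‖n‖ := abs_real_inner_le_norm _ _
    _ = ‖m - n‖ := by rw [hx.norm_eq_one, mul_one]
    _ ≤ _ := hx.expansion.norm_sub_le hx.radius_pos hm.expansion

lemma approximatesLinearOn_flatten (hx : IsTubularNormal S R x n) :
    ApproximatesLinearOn (flatten S x n) (ContinuousLinearMap.id ℝ V) (ball x (R / 24))
      (1 / 4 : ℝ≥0) := by
  intro a ha b hb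
  simpa using (convex_ball x (R / 24)).norm_image_sub_le_of_norm_hasFDerivWithin_le'
    (fun y hy => (hx.differentiableAt_flatten hy).hasFDerivAt.hasFDerivWithinAt)
    (fun y hy => hx.norm_fderiv_flatten_sub_id_le hy) hb ha

lemma injOn_flatten (hx : IsTubularNormal S R x n) :
    InjOn (flatten S x n) (ball x (R / 24)) := by
  intro a ha b hb hab
  have h := hx.approximatesLinearOn_flatten a ha b hb
  rw [hab, sub_self, zero_sub, norm_neg, ContinuousLinearMap.coe_id', id_eq] at h
  push_cast at h
  exact sub_eq_zero.1 (norm_le_zero_iff.1 (by linarith))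

lemma ball_subset_image_flatten [CompleteSpace V] (hx : IsTubularNormal S R x n) :
    ball x (R / 48) ⊆ flatten S x n '' ball x (R / 24) := by
  have hR := hx.radius_pos
  have hsub : closedBall x (R / 36) ⊆ ball x (R / 24) := closedBall_subset_ball (by linarith)
  let inv : (ContinuousLinearMap.id ℝ V).NonlinearRightInverse :=
    { toFun := id, nnnorm := 1, bound' := by simp, right_inv' := fun _ => rfl }
  have hrad : ((inv.nnnorm : ℝ)⁻¹ - ((1 / 4 : ℝ≥0) : ℝ)) * (R / 36) = R / 48 := by
    simp only [inv]
    push_cast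
    ring
  have hsurj := hx.approximatesLinearOn_flatten.surjOn_closedBall_of_nonlinearRightInverse inv
    (by positivity : (0 : ℝ) ≤ R / 36) hsub
  rw [flatten_self, hrad] at hsurj
  exact ball_subset_closedBall.trans (hsurj.trans (image_mono hsub))

lemma image_flatten_subset_ball (hx : IsTubularNormal S R x n) :
    flatten S x n '' ball x (R / 24) ⊆ ball x (R / 12) := by
  have hR := hx.radius_pos
  rintro _ ⟨y, hy, rfl⟩
  rw [mem_ball_iff_norm] at hy ⊢
  calc ‖flatten S x n y - x‖
    _ ≤ ‖flatten S x n y - y‖ + ‖y - x‖ := norm_sub_le_norm_sub_add_norm_sub ..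
    _ ≤ ‖y - x‖ ^ 2 / R + ‖y - x‖ := by gcongr; exact hx.norm_flatten_sub_le y
    _ ≤ (R / 24) ^ 2 / R + ‖y - x‖ := by gcongr
    _ < R / 12 := by
        rw [show (R / 24) ^ 2 / R = R / 576 by field_simp; norm_num]
        linarith

lemma one_le_two_mul_abs_det_fderiv_flatten [FiniteDimensional ℝ V]
    (hx : IsTubularNormal S R x n) (hy : y ∈ ball x (R / 24)) :
    1 ≤ 2 * |(fderiv ℝ (flatten S x n) y).det| := by
  have hR := hx.radius_pos
  have hdet := (abs_le.1 (hx.abs_det_fderiv_flatten_sub_one_le hy)).1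
  have hsmall : 6 / R * ‖y - x‖ ≤ 1 / 4 :=
    calc 6 / R * ‖y - x‖ ≤ 6 / R * (R / 24) := by gcongr; exact (mem_ball_iff_norm.1 hy).le
      _ = 1 / 4 := by field_simp; norm_num
  linarith [le_abs_self (fderiv ℝ (flatten S x n) y).det]

end IsTubularNormal

end Straightening

section RadialIntegrals

variable {V : Type*} [NormedAddCommGroup V] [NormedSpace ℝ V]

/-- The surface measure of the unit sphere of `V`. -/
def sphereArea (V : Type*) [NormedAddCommGroup V] [NormedSpace ℝ V] [MeasureSpace V] : ℝ :=
  Module.finrank ℝ V * volume.real (ball (0 : V) 1)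

lemma pow_smul_rpow_sub {N : ℕ} (hN : 0 < N) {t b : ℝ} (ht : 0 < t) :
    t ^ (N - 1) • t ^ (b - N) = t ^ (b - 1) := by
  rw [smul_eq_mul, ← Real.rpow_natCast, ← Real.rpow_add ht, Nat.cast_sub hN]
  congr 1
  push_cast
  ring

lemma eqOn_pow_smul_indicator_rpow {N : ℕ} (hN : 0 < N) (J : Set ℝ) (b : ℝ) :
    EqOn (fun t : ℝ => t ^ (N - 1) • J.indicator (fun t => t ^ (b - N)) t)
      (J.indicator fun t => t ^ (b - 1)) (Ioi 0) := by
  intro t ht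
  by_cases h : t ∈ J
  · simpa only [indicator_of_mem h] using pow_smul_rpow_sub hN ht
  · simp only [indicator_of_notMem h, smul_zero]

variable [FiniteDimensional ℝ V] [MeasureSpace V] [BorelSpace V]
  [(volume : Measure V).IsAddHaarMeasure] {N : ℕ} {J : Set ℝ}

lemma integrableOn_norm_sub_rpow_iff (hV : Module.finrank ℝ V = N) (hN : 0 < N)
    (hJ : MeasurableSet J) (b : ℝ) (x : V) :
    IntegrableOn (fun y => ‖y - x‖ ^ (b - N)) {y | ‖y - x‖ ∈ J} ↔
      IntegrableOn (fun t : ℝ => t ^ (b - 1)) (J ∩ Ioi 0) := by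
  have : Nontrivial V := Module.nontrivial_of_finrank_pos (R := ℝ) (hV ▸ hN)
  have hshift : MeasurePreserving (fun y => y - x) (volume : Measure V) volume :=
    measurePreserving_sub_right volume x
  have hset : MeasurableSet {y : V | ‖y - x‖ ∈ J} :=
    (measurable_id.sub_const x).norm hJ
  rw [← integrable_indicator_iff hset]
  calc _ ↔ Integrable fun y : V => J.indicator (fun t => t ^ (b - N)) ‖y‖ :=
        hshift.integrable_comp_emb (MeasurableEquiv.subRight x).measurableEmbedding
          (g := fun y => J.indicator (fun t => t ^ (b - N)) ‖y‖)
    _ ↔ IntegrableOn (J.indicator fun t => t ^ (b - 1)) (Ioi 0) := by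
        rw [integrable_fun_norm_addHaar, hV,
          integrableOn_congr_fun (eqOn_pow_smul_indicator_rpow hN J b) measurableSet_Ioi]
    _ ↔ _ := by
        rw [IntegrableOn, integrable_indicator_iff hJ, IntegrableOn,
          Measure.restrict_restrict hJ, IntegrableOn]

lemma setIntegral_norm_sub_rpow (hV : Module.finrank ℝ V = N) (hN : 0 < N)
    (hJ : MeasurableSet J) (b : ℝ) (x : V) :
    ∫ y in {y | ‖y - x‖ ∈ J}, ‖y - x‖ ^ (b - N) =
      sphereArea V * ∫ t in J ∩ Ioi 0, t ^ (b - 1) := by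
  have : Nontrivial V := Module.nontrivial_of_finrank_pos (R := ℝ) (hV ▸ hN)
  have hset : MeasurableSet {y : V | ‖y - x‖ ∈ J} :=
    (measurable_id.sub_const x).norm hJ
  rw [← integral_indicator hset]
  calc _ = ∫ y : V, J.indicator (fun t => t ^ (b - N)) ‖y‖ :=
        integral_sub_right_eq_self (fun y : V => J.indicator (fun t => t ^ (b - N)) ‖y‖) x
    _ = sphereArea V * ∫ t in Ioi 0, J.indicator (fun t => t ^ (b - 1)) t := by
        rw [integral_fun_norm_addHaar, hV,
          setIntegral_congr_fun measurableSet_Ioi (eqOn_pow_smul_indicator_rpow hN J b),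
          nsmul_eq_mul, smul_eq_mul, sphereArea, hV, mul_assoc]
    _ = _ := by rw [integral_indicator hJ, Measure.restrict_restrict hJ]

variable {a r : ℝ}

lemma integrableOn_and_integral_norm_sub_rpow_compl_ball (hV : Module.finrank ℝ V = N) (hN : 0 < N)
    (ha : 0 < a) (hr : 0 < r) (x : V) :
    IntegrableOn (fun y => ‖y - x‖ ^ (-a - N)) (ball x r)ᶜ ∧
      ∫ y in (ball x r)ᶜ, ‖y - x‖ ^ (-a - N) = sphereArea V * (r ^ (-a) / a) := by
  have hball : (ball x r)ᶜ = {y | ‖y - x‖ ∈ Ici r} := by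
    ext y
    simp [dist_eq_norm]
  have hIci : Ici r ∩ Ioi 0 = Ici r := inter_eq_left.2 fun y (hy : r ≤ y) => hr.trans_le hy
  rw [hball, integrableOn_norm_sub_rpow_iff hV hN measurableSet_Ici,
    setIntegral_norm_sub_rpow hV hN measurableSet_Ici, hIci,
    integrableOn_Ici_iff_integrableOn_Ioi, integral_Ici_eq_integral_Ioi,
    integral_Ioi_rpow_of_lt (by linarith) hr, sub_add_cancel, neg_div_neg_eq]
  exact ⟨integrableOn_Ioi_rpow_of_lt (by linarith) hr, rfl⟩

lemma integrableOn_and_integral_norm_sub_rpow_ball (hV : Module.finrank ℝ V = N) (hN : 0 < N)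
    (ha : 0 < a) (hr : 0 < r) (x : V) :
    IntegrableOn (fun y => ‖y - x‖ ^ (a - N)) (ball x r) ∧
      ∫ y in ball x r, ‖y - x‖ ^ (a - N) = sphereArea V * (r ^ a / a) := by
  have hball : ball x r = {y | ‖y - x‖ ∈ Iio r} := by
    ext y
    simp [dist_eq_norm]
  have hIoo : Iio r ∩ Ioi 0 = Ioo 0 r := Iio_inter_Ioi
  rw [hball, integrableOn_norm_sub_rpow_iff hV hN measurableSet_Iio,
    setIntegral_norm_sub_rpow hV hN measurableSet_Iio, hIoo,
    intervalIntegral.integrableOn_Ioo_rpow_iff hr, ← integral_Ioc_eq_integral_Ioo,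
    ← intervalIntegral.integral_of_le hr.le, integral_rpow (Or.inl (by linarith)), sub_add_cancel,
    Real.zero_rpow ha.ne', sub_zero]
  exact ⟨by linarith, rfl⟩

end RadialIntegrals

section Layers

/-- The integral of `(1 + ‖w‖²)^{-q/2}` over `ℝ^m`. -/
def layerConst (m : ℕ) (q : ℝ) : ℝ := ∫ w : E m, (1 + ‖w‖ ^ 2) ^ (-q / 2)

lemma layerConst_nonneg (m : ℕ) (q : ℝ) : 0 ≤ layerConst m q :=
  integral_nonneg fun w => by positivity

variable {m : ℕ} {q : ℝ}

lemma rpow_add_norm_sq_eq {V : Type*} [NormedAddCommGroup V] [NormedSpace ℝ V] {t : ℝ}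
    (ht : t ≠ 0) (q : ℝ) (w : V) :
    (t ^ 2 + ‖w‖ ^ 2) ^ (-q / 2) = |t| ^ (-q) * (1 + ‖t⁻¹ • w‖ ^ 2) ^ (-q / 2) := by
  have hscale : t ^ 2 + ‖w‖ ^ 2 = |t| ^ (2 : ℝ) * (1 + ‖t⁻¹ • w‖ ^ 2) := by
    rw [norm_smul, norm_inv, mul_pow, Real.norm_eq_abs, Real.rpow_two, inv_pow, mul_add,
      mul_inv_cancel_left₀ (by positivity), sq_abs, mul_one]
  rw [hscale, Real.mul_rpow (by positivity) (by positivity), ← Real.rpow_mul (abs_nonneg t)]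
  congr 2
  ring

lemma lintegral_layer (hq : m < q) {t : ℝ} (ht : t ≠ 0) :
    ∫⁻ w : E m, ENNReal.ofReal ((t ^ 2 + ‖w‖ ^ 2) ^ (-q / 2)) =
      ENNReal.ofReal (layerConst m q * |t| ^ (m - q)) := by
  have hint : Integrable fun w : E m => (1 + ‖w‖ ^ 2) ^ (-q / 2) :=
    integrable_rpow_neg_one_add_norm_sq (by simpa using hq)
  simp_rw [rpow_add_norm_sq_eq ht]
  rw [← ofReal_integral_eq_lintegral_ofReal ((hint.comp_smul (inv_ne_zero ht)).const_mul _)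
    (Eventually.of_forall fun w => by positivity), integral_const_mul,
    Measure.integral_comp_inv_smul volume (fun w : E m => (1 + ‖w‖ ^ 2) ^ (-q / 2)),
    finrank_euclideanSpace_fin, ← layerConst, smul_eq_mul, abs_pow, ← Real.rpow_natCast,
    sub_eq_add_neg, Real.rpow_add (abs_pos.2 ht)]
  congr 1
  ring

lemma lintegral_coord_norm_sq {f : ℝ × ℝ → ℝ≥0∞} (hf : Measurable f) :
    ∫⁻ z : E (m + 1), f (z 0, ‖z‖ ^ 2) = ∫⁻ t, ∫⁻ w : E m, f (t, t ^ 2 + ‖w‖ ^ 2) := by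
  have htoLp (k : ℕ) := EuclideanSpace.volume_preserving_symm_measurableEquiv_toLp (Fin k)
  calc _ = ∫⁻ z : Fin (m + 1) → ℝ, f (z 0, ∑ i, z i ^ 2) := by
        rw [← (htoLp (m + 1)).lintegral_comp (by fun_prop)]
        simp_rw [EuclideanSpace.real_norm_sq_eq]
        rfl
    _ = ∫⁻ z : ℝ × (Fin m → ℝ), f (z.1, z.1 ^ 2 + ∑ i, z.2 i ^ 2) := by
        rw [← (volume_preserving_piFinSuccAbove (fun _ : Fin (m + 1) => ℝ) 0).lintegral_comp
          (by fun_prop)]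
        simp_rw [Fin.sum_univ_succ]
        rfl
    _ = ∫⁻ t, ∫⁻ w : Fin m → ℝ, f (t, t ^ 2 + ∑ i, w i ^ 2) := by
        rw [Measure.volume_eq_prod, lintegral_prod _ (by fun_prop)]
    _ = _ := by
        refine lintegral_congr fun t => ?_
        rw [← (htoLp m).lintegral_comp (by fun_prop)]
        simp_rw [EuclideanSpace.real_norm_sq_eq]
        rfl

lemma exists_orthonormalBasis_zero_eq {n : E (m + 1)} (hn : ‖n‖ = 1) :
    ∃ b : OrthonormalBasis (Fin (m + 1)) ℝ (E (m + 1)), b 0 = n := by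
  have honb : Orthonormal ℝ (({0} : Set (Fin (m + 1))).domRestrict fun _ => n) :=
    ⟨fun _ => hn, fun i j hij => absurd (Subsingleton.elim i j) hij⟩
  obtain ⟨b, hb⟩ := honb.exists_orthonormalBasis_extension_of_card_eq (by simp)
  exact ⟨b, hb 0 rfl⟩

lemma lintegral_inner_norm_sq {n : E (m + 1)} (hn : ‖n‖ = 1) {f : ℝ × ℝ → ℝ≥0∞}
    (hf : Measurable f) :
    ∫⁻ z : E (m + 1), f (inner ℝ n z, ‖z‖ ^ 2) =
      ∫⁻ t, ∫⁻ w : E m, f (t, t ^ 2 + ‖w‖ ^ 2) := by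
  obtain ⟨b, rfl⟩ := exists_orthonormalBasis_zero_eq hn
  rw [← lintegral_coord_norm_sq hf, ← b.measurePreserving_repr.lintegral_comp
    (f := fun z => f (z 0, ‖z‖ ^ 2)) (by fun_prop)]
  simp only [b.repr_apply_apply, b.repr.norm_map]

lemma lintegral_inner_mul_norm_rpow (hq : m < q) {n : E (m + 1)} (hn : ‖n‖ = 1)
    {g : ℝ → ℝ≥0∞} (hg : Measurable g) :
    ∫⁻ z : E (m + 1), g (inner ℝ n z) * ENNReal.ofReal (‖z‖ ^ (-q)) =
      ENNReal.ofReal (layerConst m q) * ∫⁻ t, g t * ENNReal.ofReal (|t| ^ (m - q)) := by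
  have hsq : ∀ z : E (m + 1), ‖z‖ ^ (-q) = (‖z‖ ^ 2) ^ (-q / 2) := fun z => by
    rw [← Real.rpow_two, ← Real.rpow_mul (norm_nonneg z), mul_div_cancel₀ _ two_ne_zero]
  have hne : ∀ᵐ t : ℝ, t ≠ 0 := by simp [ae_iff]
  simp_rw [hsq]
  rw [lintegral_inner_norm_sq hn (f := fun w => g w.1 * ENNReal.ofReal (w.2 ^ (-q / 2)))
    (by fun_prop), ← lintegral_const_mul _ (by fun_prop)]
  refine lintegral_congr_ae ?_
  filter_upwards [hne] with t ht
  rw [lintegral_const_mul _ (by fun_prop), mul_left_comm,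
    ← ENNReal.ofReal_mul (layerConst_nonneg _ _), ← lintegral_layer hq ht]

lemma integral_inner_mul_norm_rpow (hq : m < q) {n : E (m + 1)} (hn : ‖n‖ = 1)
    {g : ℝ → ℝ} (hg : Measurable g)
    (hgV : Integrable fun z : E (m + 1) => g (inner ℝ n z) * ‖z‖ ^ (-q))
    (hgℝ : Integrable fun t => g t * |t| ^ (m - q)) :
    ∫ z : E (m + 1), g (inner ℝ n z) * ‖z‖ ^ (-q) =
      layerConst m q * ∫ t, g t * |t| ^ (m - q) := by
  have hpart : ∀ f : ℝ → ℝ, Measurable f →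
      (∫⁻ z : E (m + 1), ENNReal.ofReal (f (inner ℝ n z) * ‖z‖ ^ (-q))).toReal =
      layerConst m q * (∫⁻ t, ENNReal.ofReal (f t * |t| ^ (m - q))).toReal := by
    intro f hf
    have := lintegral_inner_mul_norm_rpow hq hn (g := fun t => ENNReal.ofReal (f t)) (by fun_prop)
    simp_rw [← ENNReal.ofReal_mul' (Real.rpow_nonneg (norm_nonneg _) _),
      ← ENNReal.ofReal_mul' (Real.rpow_nonneg (abs_nonneg _) _)] at this
    rw [this, ENNReal.toReal_mul, ENNReal.toReal_ofReal (layerConst_nonneg _ _)]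
  rw [integral_eq_lintegral_pos_part_sub_lintegral_neg_part hgV,
    integral_eq_lintegral_pos_part_sub_lintegral_neg_part hgℝ, hpart g hg, mul_sub]
  simp_rw [← neg_mul]
  rw [hpart (fun t => -g t) hg.neg]

end Layers

section Profile

lemma abs_spow {x q : ℝ} (hq : 0 < q) : |spow x q| = |x| ^ q := by
  unfold spow
  rcases eq_or_ne x 0 with rfl | hx
  · simp [Real.zero_rpow hq.ne']
  · rw [abs_mul, abs_of_nonneg (Real.rpow_nonneg (abs_nonneg x) _)]
    nth_rewrite 2 [← Real.rpow_one |x|]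
    rw [← Real.rpow_add (abs_pos.2 hx), sub_add_cancel]

lemma spow_neg (x q : ℝ) : spow (-x) q = -spow x q := by simp [spow]

lemma spow_zero (q : ℝ) : spow 0 q = 0 := by simp [spow]

lemma spow_mul (x y q : ℝ) : spow (x * y) q = spow x q * spow y q := by
  rw [spow, abs_mul, Real.mul_rpow (abs_nonneg x) (abs_nonneg y), spow, spow]
  ring

lemma spow_of_pos {x q : ℝ} (hx : 0 < x) : spow x q = x ^ q := by
  rw [spow, abs_of_pos hx]
  nth_rewrite 2 [← Real.rpow_one x]
  rw [← Real.rpow_add hx, sub_add_cancel]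

lemma measurable_spow (q : ℝ) : Measurable fun x => spow x q := by
  unfold spow
  fun_prop

lemma abs_rpow_sub_rpow_le {s a b : ℝ} (hs0 : 0 < s) (hs1 : s < 1) (ha : 0 ≤ a) (hb : 0 ≤ b) :
    |a ^ s - b ^ s| ≤ |a - b| ^ s := by
  wlog h : b ≤ a generalizing a b
  · rw [abs_sub_comm, abs_sub_comm a b]
    exact this hb ha (not_le.1 h).le
  have hpow : b ^ s ≤ a ^ s := by gcongr
  rw [abs_of_nonneg (sub_nonneg.2 hpow), abs_of_nonneg (sub_nonneg.2 h)]
  have := Real.rpow_add_le_add_rpow (sub_nonneg.2 h) hb hs0.le hs1.le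
  rw [sub_add_cancel] at this
  linarith

/-- The signed power of `a ^ s - b ^ s`, cut off where `a` and `b` are close to each other relative
to their size. -/
def profile (s p κ a b : ℝ) : ℝ :=
  if b ≤ κ * a ∨ a ≤ κ * b then spow (a ^ s - b ^ s) (p - 1) else 0

variable {s p κ : ℝ}

lemma profile_swap (a b : ℝ) : profile s p κ b a = -profile s p κ a b := by
  unfold profile
  rw [if_congr (or_comm (a := a ≤ κ * b)) rfl rfl, ← neg_sub, spow_neg]
  split_ifs <;> simp

lemma abs_spow_rpow_sub_le (hs0 : 0 < s) (hs1 : s < 1) (hp : 1 < p) {a b : ℝ} (ha : 0 ≤ a)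
    (hb : 0 ≤ b) : |spow (a ^ s - b ^ s) (p - 1)| ≤ |a - b| ^ (s * (p - 1)) := by
  rw [abs_spow (by linarith), Real.rpow_mul (abs_nonneg _)]
  have := abs_rpow_sub_rpow_le hs0 hs1 ha hb
  have : 0 ≤ p - 1 := by linarith
  gcongr

lemma abs_profile_le_abs_spow (a b : ℝ) :
    |profile s p κ a b| ≤ |spow (a ^ s - b ^ s) (p - 1)| := by
  unfold profile
  split_ifs
  · exact le_rfl
  · simp

lemma abs_profile_le (hs0 : 0 < s) (hs1 : s < 1) (hp : 1 < p) {a b : ℝ} (ha : 0 ≤ a)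
    (hb : 0 ≤ b) : |profile s p κ a b| ≤ |a - b| ^ (s * (p - 1)) :=
  (abs_profile_le_abs_spow a b).trans (abs_spow_rpow_sub_le hs0 hs1 hp ha hb)

lemma profile_eq_zero (hκ0 : 0 < κ) (hκ1 : κ < 1) {a b : ℝ}
    (h : |a - b| < (1 - κ) * a) : profile s p κ a b = 0 := by
  unfold profile
  rw [abs_lt] at h
  rw [if_neg]
  push Not
  constructor
  · linarith
  · nlinarith

lemma measurable_profile : Measurable fun z : ℝ × ℝ => profile s p κ z.1 z.2 := by
  unfold profile
  refine Measurable.ite ?_ ?_ measurable_const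
  · exact (measurableSet_le measurable_snd (measurable_fst.const_mul κ)).union
      (measurableSet_le measurable_fst (measurable_snd.const_mul κ))
  · exact (measurable_spow _).comp (by fun_prop)

lemma tendsto_profile (a b : ℝ) {κ : ℕ → ℝ}
    (hκ : Tendsto κ atTop (𝓝 1)) :
    Tendsto (fun k => profile s p (κ k) a b) atTop
      (𝓝 (spow (a ^ s - b ^ s) (p - 1))) := by
  rcases lt_trichotomy a b with h | h | h
  · refine tendsto_const_nhds.congr' ?_
    have : Tendsto (fun k => κ k * b) atTop (𝓝 (1 * b)) := hκ.mul_const b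
    filter_upwards [this.eventually (lt_mem_nhds (show a < 1 * b by linarith))] with k hk
    rw [profile, if_pos (Or.inr hk.le)]
  · subst h
    simp [profile, spow_zero]
  · refine tendsto_const_nhds.congr' ?_
    have : Tendsto (fun k => κ k * a) atTop (𝓝 (1 * a)) := hκ.mul_const a
    filter_upwards [this.eventually (lt_mem_nhds (show b < 1 * a by linarith))] with k hk
    rw [profile, if_pos (Or.inl hk.le)]

lemma profile_mul {d : ℝ} (hd : 0 < d) {t : ℝ} (ht : 0 ≤ t) :
    profile s p κ d (d * t) = d ^ (s * (p - 1)) * profile s p κ 1 t := by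
  have hleft : d * t ≤ κ * d ↔ t ≤ κ * 1 := by
    rw [mul_comm κ d, mul_le_mul_iff_right₀ hd, mul_one]
  have hright : d ≤ κ * (d * t) ↔ 1 ≤ κ * t := by
    rw [mul_left_comm]
    exact le_mul_iff_one_le_right hd
  have hdiff : d ^ s - (d * t) ^ s = d ^ s * (1 ^ s - t ^ s) := by
    rw [Real.mul_rpow hd.le ht, Real.one_rpow]
    ring
  unfold profile
  rw [if_congr (or_congr hleft hright) rfl rfl, hdiff, spow_mul,
    spow_of_pos (Real.rpow_pos_of_pos hd s), ← Real.rpow_mul hd.le, mul_ite, mul_zero]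

/-- The value at `1` of the one-dimensional operator truncated by `κ`, applied to `t_+ ^ s`, up to
the factor `p * s`. -/
def profileDefect (s p κ : ℝ) : ℝ := (1 - κ ^ s) ^ p * (1 - κ) ^ (-(p * s))

lemma profileDefect_nonneg (hs0 : 0 < s) (hκ0 : 0 < κ) (hκ1 : κ < 1) :
    0 ≤ profileDefect s p κ := by
  have hκs : 0 ≤ 1 - κ ^ s := sub_nonneg.2 (Real.rpow_le_one hκ0.le hκ1.le hs0.le)
  have : 0 ≤ 1 - κ := sub_nonneg.2 hκ1.le
  unfold profileDefect
  positivity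

lemma profileDefect_le (hs0 : 0 < s) (hs1 : s < 1) (hp : 1 < p) (hκ0 : 0 < κ) (hκ1 : κ < 1) :
    profileDefect s p κ ≤ (1 - κ) ^ (p * (1 - s)) := by
  have hκs1 : κ ^ s ≤ 1 := Real.rpow_le_one hκ0.le hκ1.le hs0.le
  have hκs : κ ≤ κ ^ s := Real.self_le_rpow_of_le_one hκ0.le hκ1.le hs1.le
  have hκ : 0 < 1 - κ := sub_pos.2 hκ1
  calc profileDefect s p κ ≤ (1 - κ) ^ p * (1 - κ) ^ (-(p * s)) := by
        unfold profileDefect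
        gcongr
    _ = (1 - κ) ^ (p * (1 - s)) := by
        rw [← Real.rpow_add hκ]
        congr 1
        ring

lemma profileDefect_le_one (hs0 : 0 < s) (hs1 : s < 1) (hp : 1 < p) (hκ0 : 0 < κ) (hκ1 : κ < 1) :
    profileDefect s p κ ≤ 1 :=
  (profileDefect_le hs0 hs1 hp hκ0 hκ1).trans
    (Real.rpow_le_one (by linarith) (by linarith) (mul_nonneg (by linarith) (by linarith)))

lemma tendsto_profileDefect (hs0 : 0 < s) (hs1 : s < 1) (hp : 1 < p) {κ : ℕ → ℝ}
    (hκ0 : ∀ k, 0 < κ k) (hκ1 : ∀ k, κ k < 1)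
    (hκ : Tendsto κ atTop (𝓝 1)) :
    Tendsto (fun k => profileDefect s p (κ k)) atTop (𝓝 0) := by
  have hexp : 0 < p * (1 - s) := mul_pos (by linarith) (by linarith)
  have hlim : Tendsto (fun k => (1 - κ k) ^ (p * (1 - s))) atTop (𝓝 0) := by
    have := (hκ.const_sub 1).rpow_const (p := p * (1 - s)) (Or.inr hexp.le)
    rwa [sub_self, Real.zero_rpow hexp.ne'] at this
  exact squeeze_zero (fun k => profileDefect_nonneg hs0 (hκ0 k) (hκ1 k))
    (fun k => profileDefect_le hs0 hs1 hp (hκ0 k) (hκ1 k)) hlim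

/-- The integrand at `t ∈ (0, κ]` of the one-dimensional operator at `1` applied to `t_+ ^ s`. -/
def profileKernel (s p t : ℝ) : ℝ := (1 - t ^ s) ^ (p - 1) * (1 - t) ^ (-1 - p * s)

lemma one_sub_rpow_pos (hs0 : 0 < s) {t : ℝ} (ht0 : 0 ≤ t) (ht1 : t < 1) : 0 < 1 - t ^ s :=
  sub_pos.2 (Real.rpow_lt_one ht0 ht1 hs0)

lemma hasDerivAt_profileDefect (hs0 : 0 < s) {t : ℝ} (ht0 : 0 < t) (ht1 : t < 1) :
    HasDerivAt (profileDefect s p) (p * s * (profileKernel s p t * (1 - t ^ (s - 1)))) t := by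
  have hts := one_sub_rpow_pos hs0 ht0.le ht1
  have ht : 0 < 1 - t := sub_pos.2 ht1
  have hleft := ((Real.hasDerivAt_rpow_const (p := s) (Or.inl ht0.ne')).const_sub 1).rpow_const
    (p := p) (Or.inl hts.ne')
  have hright := ((hasDerivAt_id t).const_sub 1).rpow_const (p := -(p * s)) (Or.inl ht.ne')
  refine (hleft.mul hright).congr_deriv ?_
  have hp_pow : (1 - t ^ s) ^ p = (1 - t ^ s) ^ (p - 1) * (1 - t ^ s) := by
    rw [Real.rpow_sub_one hts.ne', div_mul_cancel₀ _ hts.ne']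
  have hps_pow : (1 - t) ^ (-(p * s)) = (1 - t) ^ (-1 - p * s) * (1 - t) := by
    rw [show -1 - p * s = -(p * s) - 1 by ring, Real.rpow_sub_one ht.ne', div_mul_cancel₀ _ ht.ne']
  have hs_pow : t ^ s = t ^ (s - 1) * t := by
    rw [Real.rpow_sub_one ht0.ne', div_mul_cancel₀ _ ht0.ne']
  rw [id, hps_pow, hp_pow, profileKernel, show -(p * s) - 1 = -1 - p * s by ring]
  generalize (1 - t) ^ (-1 - p * s) = A
  generalize (1 - t ^ s) ^ (p - 1) = B
  rw [hs_pow]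
  ring

lemma continuousOn_one_sub_rpow_mul_rpow {q r : ℝ} (hs0 : 0 < s) (hq : 0 ≤ q) (hκ1 : κ < 1) :
    ContinuousOn (fun t : ℝ => (1 - t ^ s) ^ q * (1 - t) ^ r) (Icc 0 κ) := by
  have hleft : Continuous fun t : ℝ => (1 - t ^ s) ^ q :=
    (continuous_const.sub (Real.continuous_rpow_const hs0.le)).rpow_const fun _ => Or.inr hq
  exact hleft.continuousOn.mul (ContinuousOn.rpow_const (by fun_prop) fun t ht =>
    Or.inl (sub_pos.2 (ht.2.trans_lt hκ1)).ne')

lemma intervalIntegrable_profileKernel (hs0 : 0 < s) (hp : 1 < p) (hκ0 : 0 < κ) (hκ1 : κ < 1) :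
    IntervalIntegrable (profileKernel s p) volume 0 κ := by
  have hcont := continuousOn_one_sub_rpow_mul_rpow (r := -1 - p * s) hs0 (sub_pos.2 hp).le hκ1
  rw [← uIcc_of_le hκ0.le] at hcont
  exact hcont.intervalIntegrable

lemma intervalIntegrable_profileKernel_mul_rpow (hs0 : 0 < s) (hp : 1 < p) (hκ0 : 0 < κ)
    (hκ1 : κ < 1) :
    IntervalIntegrable (fun t => profileKernel s p t * t ^ (s - 1)) volume 0 κ := by
  have hcont := continuousOn_one_sub_rpow_mul_rpow (r := -1 - p * s) hs0 (sub_pos.2 hp).le hκ1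
  rw [← uIcc_of_le hκ0.le] at hcont
  exact (intervalIntegral.intervalIntegrable_rpow' (by linarith)).continuousOn_mul hcont

lemma integral_profileKernel_mul_one_sub_rpow (hs0 : 0 < s) (hp : 1 < p) (hκ0 : 0 < κ)
    (hκ1 : κ < 1) :
    ∫ t in 0..κ, profileKernel s p t * (1 - t ^ (s - 1)) = (profileDefect s p κ - 1) / (p * s) := by
  have hint : IntervalIntegrable
      (fun t => p * s * (profileKernel s p t * (1 - t ^ (s - 1)))) volume 0 κ := by
    simp_rw [mul_sub (profileKernel s p _), mul_one]
    exact ((intervalIntegrable_profileKernel hs0 hp hκ0 hκ1).sub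
      (intervalIntegrable_profileKernel_mul_rpow hs0 hp hκ0 hκ1)).const_mul (p * s)
  have hFTC := intervalIntegral.integral_eq_sub_of_hasDerivAt_of_le hκ0.le
    (continuousOn_one_sub_rpow_mul_rpow hs0 (by linarith) hκ1)
    (fun t ht => hasDerivAt_profileDefect hs0 ht.1 (ht.2.trans hκ1)) hint
  have hzero : profileDefect s p 0 = 1 := by simp [profileDefect, Real.zero_rpow hs0.ne']
  rw [intervalIntegral.integral_const_mul, ← profileDefect, ← profileDefect, hzero] at hFTC
  rw [eq_div_iff (by positivity), mul_comm, hFTC]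

lemma image_inv_Ioc_zero {a : ℝ} (ha : 0 < a) : Inv.inv '' Ioc 0 a = Ici a⁻¹ := by
  ext t
  rw [image_inv_eq_inv, Set.mem_inv, mem_Ioc, inv_pos, mem_Ici]
  refine ⟨fun h => (inv_le_comm₀ h.1 ha).1 h.2, fun h => ?_⟩
  have ht : 0 < t := (inv_pos.2 ha).trans_le h
  exact ⟨ht, (inv_le_comm₀ ht ha).2 h⟩

lemma integrableOn_Ici_inv_iff {a : ℝ} (ha : 0 < a) (g : ℝ → ℝ) :
    IntegrableOn g (Ici a⁻¹) ↔ IntegrableOn (fun t => (t ^ 2)⁻¹ * g t⁻¹) (Ioc 0 a) := by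
  rw [← image_inv_Ioc_zero ha, integrableOn_image_iff_integrableOn_abs_deriv_smul measurableSet_Ioc
    (fun t ht => (hasDerivAt_inv ht.1.ne').hasDerivWithinAt) inv_injective.injOn]
  simp only [abs_neg, abs_inv, abs_sq, smul_eq_mul]

lemma setIntegral_Ici_inv {a : ℝ} (ha : 0 < a) (g : ℝ → ℝ) :
    ∫ t in Ici a⁻¹, g t = ∫ t in Ioc 0 a, (t ^ 2)⁻¹ * g t⁻¹ := by
  rw [← image_inv_Ioc_zero ha, integral_image_eq_integral_abs_deriv_smul measurableSet_Ioc
    (fun t ht => (hasDerivAt_inv ht.1.ne').hasDerivWithinAt) inv_injective.injOn]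
  simp only [abs_neg, abs_inv, abs_sq, smul_eq_mul]

/-- The integrand on `[κ⁻¹, ∞)` becomes `-profileKernel s p t * t ^ (s - 1)` under `t ↦ t⁻¹`. -/
lemma inv_sq_mul_profile_inv (hs0 : 0 < s) {t : ℝ} (ht0 : 0 < t) (ht1 : t < 1) :
    (t ^ 2)⁻¹ * (spow (1 - t⁻¹ ^ s) (p - 1) * |t⁻¹ - 1| ^ (-1 - p * s)) =
      -(profileKernel s p t * t ^ (s - 1)) := by
  have hts := one_sub_rpow_pos hs0 ht0.le ht1
  have ht : 0 < 1 - t := sub_pos.2 ht1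
  have hdiff : 1 - t⁻¹ ^ s = -((1 - t ^ s) * t ^ (-s)) := by
    have : 0 < t ^ s := Real.rpow_pos_of_pos ht0 s
    rw [Real.inv_rpow ht0.le, Real.rpow_neg ht0.le]
    field_simp
    ring
  have habs : |t⁻¹ - 1| = (1 - t) * t ^ (-1 : ℝ) := by
    rw [Real.rpow_neg_one, abs_of_pos (sub_pos.2 ((one_lt_inv₀ ht0).2 ht1))]
    field_simp
  have hpow : t ^ (s - 1) = (t ^ 2)⁻¹ * t ^ (-s * (p - 1)) * t ^ (-1 * (-1 - p * s)) := by
    rw [← Real.rpow_two, ← Real.rpow_neg ht0.le, ← Real.rpow_add ht0, ← Real.rpow_add ht0]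
    congr 1
    ring
  rw [hdiff, habs, spow_neg, spow_of_pos (by positivity), Real.mul_rpow hts.le (by positivity),
    Real.mul_rpow ht.le (by positivity), ← Real.rpow_mul ht0.le, ← Real.rpow_mul ht0.le, hpow,
    profileKernel]
  ring

lemma integrableOn_and_integral_profile_Iic (hs0 : 0 < s) (hp : 1 < p) (hκ0 : 0 < κ) :
    IntegrableOn (fun t => profile s p κ 1 (max t 0) * |t - 1| ^ (-1 - p * s)) (Iic 0) ∧
      ∫ t in Iic 0, profile s p κ 1 (max t 0) * |t - 1| ^ (-1 - p * s) = 1 / (p * s) := by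
  have hps : 0 < p * s := by positivity
  have hcongr : EqOn (fun t => profile s p κ 1 (max t 0) * |t - 1| ^ (-1 - p * s))
      (fun t => (1 - t) ^ (-1 - p * s)) (Iic 0) := by
    intro t (ht : t ≤ 0)
    dsimp only
    rw [max_eq_right ht, profile, if_pos (Or.inl (by positivity)), Real.one_rpow,
      Real.zero_rpow hs0.ne', sub_zero, spow_of_pos one_pos, Real.one_rpow, one_mul, abs_sub_comm,
      abs_of_nonneg (by linarith)]
  have hshift : MeasurePreserving (fun t : ℝ => 1 - t) volume volume :=
    Measure.measurePreserving_sub_left volume 1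
  have hemb := (MeasurableEquiv.subLeft (1 : ℝ)).measurableEmbedding
  have hpre : (fun t : ℝ => 1 - t) ⁻¹' Ici 1 = Iic 0 := by
    ext t
    simp
  rw [integrableOn_congr_fun hcongr measurableSet_Iic,
    setIntegral_congr_fun measurableSet_Iic hcongr, ← hpre]
  constructor
  · refine (hshift.integrableOn_comp_preimage hemb (f := fun t => t ^ (-1 - p * s))).2 ?_
    rw [integrableOn_Ici_iff_integrableOn_Ioi]
    exact integrableOn_Ioi_rpow_of_lt (by linarith) one_pos
  · refine (hshift.setIntegral_preimage_emb hemb (fun t => t ^ (-1 - p * s)) (Ici 1)).trans ?_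
    rw [integral_Ici_eq_integral_Ioi, integral_Ioi_rpow_of_lt (by linarith) one_pos, Real.one_rpow,
      show -1 - p * s + 1 = -(p * s) by ring, neg_div_neg_eq]

lemma integrableOn_and_integral_profile_Ioc (hs0 : 0 < s) (hp : 1 < p) (hκ0 : 0 < κ)
    (hκ1 : κ < 1) :
    IntegrableOn (fun t => profile s p κ 1 (max t 0) * |t - 1| ^ (-1 - p * s)) (Ioc 0 κ) ∧
      ∫ t in Ioc 0 κ, profile s p κ 1 (max t 0) * |t - 1| ^ (-1 - p * s) =
        ∫ t in 0..κ, profileKernel s p t := by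
  have hcongr : EqOn (fun t => profile s p κ 1 (max t 0) * |t - 1| ^ (-1 - p * s))
      (profileKernel s p) (Ioc 0 κ) := by
    intro t ht
    have ht1 : t < 1 := ht.2.trans_lt hκ1
    dsimp only
    rw [max_eq_left ht.1.le, profile, if_pos (Or.inl (by rw [mul_one]; exact ht.2)), Real.one_rpow,
      spow_of_pos (one_sub_rpow_pos hs0 ht.1.le ht1), abs_sub_comm,
      abs_of_pos (sub_pos.2 ht1), profileKernel]
  rw [integrableOn_congr_fun hcongr measurableSet_Ioc,
    setIntegral_congr_fun measurableSet_Ioc hcongr, intervalIntegral.integral_of_le hκ0.le]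
  exact ⟨(intervalIntegrable_iff_integrableOn_Ioc_of_le hκ0.le).1
    (intervalIntegrable_profileKernel hs0 hp hκ0 hκ1), rfl⟩

lemma profile_eq_zero_of_mem_Ioo (hκ0 : 0 < κ) {t : ℝ} (ht : t ∈ Ioo κ κ⁻¹) :
    profile s p κ 1 t = 0 := by
  rw [profile, if_neg]
  push Not
  exact ⟨by rw [mul_one]; exact ht.1, by
    simpa only [mul_inv_cancel₀ hκ0.ne'] using mul_lt_mul_of_pos_left ht.2 hκ0⟩

lemma integrableOn_and_integral_profile_Ioi (hs0 : 0 < s) (hp : 1 < p) (hκ0 : 0 < κ)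
    (hκ1 : κ < 1) :
    IntegrableOn (fun t => profile s p κ 1 (max t 0) * |t - 1| ^ (-1 - p * s)) (Ioi κ) ∧
      ∫ t in Ioi κ, profile s p κ 1 (max t 0) * |t - 1| ^ (-1 - p * s) =
        -∫ t in 0..κ, profileKernel s p t * t ^ (s - 1) := by
  have hκinv : κ < κ⁻¹ := hκ1.trans ((one_lt_inv₀ hκ0).2 hκ1)
  have hzero : ∀ t ∈ Ioi κ \ Ici κ⁻¹,
      profile s p κ 1 (max t 0) * |t - 1| ^ (-1 - p * s) = 0 := by
    intro t ht
    rw [max_eq_left (hκ0.trans ht.1).le, profile_eq_zero_of_mem_Ioo hκ0 ⟨ht.1, not_le.1 ht.2⟩,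
      zero_mul]
  have hcongr : EqOn
      (fun t => (t ^ 2)⁻¹ * (profile s p κ 1 (max t⁻¹ 0) * |t⁻¹ - 1| ^ (-1 - p * s)))
      (fun t => -(profileKernel s p t * t ^ (s - 1))) (Ioc 0 κ) := by
    intro t ht
    have hcut : 1 ≤ κ * t⁻¹ := by rw [← div_eq_mul_inv, one_le_div ht.1]; exact ht.2
    dsimp only
    rw [max_eq_left (inv_pos.2 ht.1).le, profile, if_pos (Or.inr hcut), Real.one_rpow,
      inv_sq_mul_profile_inv hs0 ht.1 (ht.2.trans_lt hκ1)]
  have hsub : Ici κ⁻¹ ⊆ Ioi κ := fun t ht => hκinv.trans_le ht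
  rw [setIntegral_eq_of_subset_of_forall_sdiff_eq_zero measurableSet_Ioi hsub hzero,
    setIntegral_Ici_inv hκ0, setIntegral_congr_fun measurableSet_Ioc hcongr,
    intervalIntegral.integral_of_le hκ0.le, integral_neg]
  refine ⟨IntegrableOn.of_forall_sdiff_eq_zero ?_ measurableSet_Ioi hzero, rfl⟩
  rw [integrableOn_Ici_inv_iff hκ0, integrableOn_congr_fun hcongr measurableSet_Ioc]
  exact ((intervalIntegrable_iff_integrableOn_Ioc_of_le hκ0.le).1
    (intervalIntegrable_profileKernel_mul_rpow hs0 hp hκ0 hκ1)).neg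

lemma integrable_and_integral_profile_one (hs0 : 0 < s) (hp : 1 < p) (hκ0 : 0 < κ)
    (hκ1 : κ < 1) :
    Integrable (fun t => profile s p κ 1 (max t 0) * |t - 1| ^ (-1 - p * s)) ∧
      ∫ t, profile s p κ 1 (max t 0) * |t - 1| ^ (-1 - p * s) =
        profileDefect s p κ / (p * s) := by
  obtain ⟨hint_neg, hval_neg⟩ := integrableOn_and_integral_profile_Iic hs0 hp hκ0
  obtain ⟨hint_near, hval_near⟩ := integrableOn_and_integral_profile_Ioc hs0 hp hκ0 hκ1
  obtain ⟨hint_far, hval_far⟩ := integrableOn_and_integral_profile_Ioi hs0 hp hκ0 hκ1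
  have hdisj : Disjoint (Ioc 0 κ) (Ioi κ) := Ioc_disjoint_Ioi le_rfl
  have hint_pos := hint_near.union hint_far
  rw [Ioc_union_Ioi_eq_Ioi hκ0.le] at hint_pos
  have hdefect := integral_profileKernel_mul_one_sub_rpow hs0 hp hκ0 hκ1
  simp_rw [mul_sub, mul_one] at hdefect
  rw [intervalIntegral.integral_sub (intervalIntegrable_profileKernel hs0 hp hκ0 hκ1)
    (intervalIntegrable_profileKernel_mul_rpow hs0 hp hκ0 hκ1)] at hdefect
  constructor
  · rw [← integrableOn_univ, ← Iic_union_Ioi (a := (0 : ℝ))]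
    exact hint_neg.union hint_pos
  · rw [← intervalIntegral.integral_Iic_add_Ioi hint_neg hint_pos, ← Ioc_union_Ioi_eq_Ioi hκ0.le,
      setIntegral_union hdisj measurableSet_Ioi hint_near hint_far, hval_neg, hval_near, hval_far,
      ← sub_eq_add_neg, hdefect]
    ring

lemma integrable_and_integral_profile (hs0 : 0 < s) (hp : 1 < p) (hκ0 : 0 < κ) (hκ1 : κ < 1) {d : ℝ}
    (hd : 0 < d) :
    Integrable (fun t => profile s p κ d (max (d + t) 0) * |t| ^ (-1 - p * s)) ∧
      ∫ t, profile s p κ d (max (d + t) 0) * |t| ^ (-1 - p * s) =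
        d ^ (-s) * (profileDefect s p κ / (p * s)) := by
  obtain ⟨hint, hval⟩ := integrable_and_integral_profile_one hs0 hp hκ0 hκ1
  set G : ℝ → ℝ := fun t => profile s p κ 1 (max t 0) * |t - 1| ^ (-1 - p * s) with hG
  have hscale : (fun t => profile s p κ d (max (d + t) 0) * |t| ^ (-1 - p * s)) =
      fun t => d ^ (s * (p - 1) + (-1 - p * s)) * G (d⁻¹ * (d + t)) := by
    ext t
    have hmax : max (d + t) 0 = d * max (d⁻¹ * (d + t)) 0 := by
      rw [mul_max_of_nonneg _ _ hd.le, mul_zero, mul_inv_cancel_left₀ hd.ne']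
    have habs : |t| = d * |d⁻¹ * (d + t) - 1| := by
      nth_rewrite 1 [← abs_of_pos hd]
      rw [← abs_mul, mul_sub, mul_inv_cancel_left₀ hd.ne']
      congr 1
      ring
    rw [hmax, profile_mul hd (le_max_right _ _)]
    rw [habs, Real.mul_rpow hd.le (abs_nonneg _), Real.rpow_add hd, hG]
    ring
  have hintG : Integrable fun t => G (d⁻¹ * (d + t)) :=
    (hint.comp_mul_left' (inv_ne_zero hd.ne')).comp_add_left d
  rw [hscale]
  refine ⟨hintG.const_mul _, ?_⟩
  rw [integral_const_mul, integral_add_left_eq_self (fun t => G (d⁻¹ * t)) d,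
    Measure.integral_comp_mul_left, hval, inv_inv, abs_of_pos hd, smul_eq_mul, ← mul_assoc]
  congr 1
  nth_rewrite 2 [← Real.rpow_one d]
  rw [← Real.rpow_add hd]
  congr 1
  ring

end Profile

section Kernel

lemma abs_rpow_neg_sub_le {q a b : ℝ} (hq : 0 < q) (ha : 0 < a) (hb : a / 2 ≤ b) :
    |a ^ (-q) - b ^ (-q)| ≤ q * 2 ^ (q + 1) * a ^ (-q - 1) * |a - b| := by
  have hpos : ∀ t ∈ Ici (a / 2), 0 < t := fun t ht => (half_pos ha).trans_le ht
  have hbound : ∀ t ∈ Ici (a / 2), ‖-q * t ^ (-q - 1)‖ ≤ q * 2 ^ (q + 1) * a ^ (-q - 1) := by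
    intro t ht
    have ht0 := hpos t ht
    rw [norm_mul, norm_neg, Real.norm_of_nonneg hq.le, Real.norm_of_nonneg (by positivity),
      mul_assoc]
    gcongr
    calc t ^ (-q - 1) ≤ (a / 2) ^ (-q - 1) :=
          Real.rpow_le_rpow_of_nonpos (half_pos ha) ht (by linarith)
      _ = 2 ^ (q + 1) * a ^ (-q - 1) := by
          rw [Real.div_rpow ha.le two_pos.le, show -q - 1 = -(q + 1) by ring,
            Real.rpow_neg two_pos.le, div_inv_eq_mul, mul_comm]
  simpa only [Real.norm_eq_abs] using
    (convex_Ici (a / 2)).norm_image_sub_le_of_norm_hasDerivWithin_le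
      (fun t ht => (Real.hasDerivAt_rpow_const (Or.inl (hpos t ht).ne')).hasDerivWithinAt)
      hbound hb (half_le_self ha.le)

/-- The constant in the comparison of the kernel `‖y - x‖ ^ (-q)` with its pullback under
`flatten`. -/
def kernelConst (q R : ℝ) : ℝ := (q * 2 ^ (q + 1) + 6 * 2 ^ q) / R

lemma kernelConst_nonneg {q R : ℝ} (hq : 0 < q) (hR : 0 < R) : 0 ≤ kernelConst q R := by
  unfold kernelConst
  positivity

lemma abs_rpow_neg_sub_mul_rpow_neg_le {q R a b J : ℝ} (hq : 0 < q) (hR : 0 < R) (ha : 0 < a)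
    (haR : a < R / 24) (hab : |a - b| ≤ a ^ 2 / R) (hJ : |1 - J| ≤ 6 / R * a) :
    |a ^ (-q) - J * b ^ (-q)| ≤ kernelConst q R * a ^ (1 - q) := by
  have hsmall : a ^ 2 / R ≤ a / 24 := by
    rw [div_le_iff₀ hR]
    nlinarith
  have hb : a / 2 ≤ b := by linarith [(abs_le.1 (hab.trans hsmall)).2]
  have hb0 : 0 ≤ b ^ (-q) := Real.rpow_nonneg ((half_pos ha).le.trans hb) _
  have hbq : b ^ (-q) ≤ 2 ^ q * a ^ (-q) := by
    refine (Real.rpow_le_rpow_of_nonpos (half_pos ha) hb (by linarith)).trans_eq ?_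
    rw [Real.div_rpow ha.le two_pos.le, Real.rpow_neg two_pos.le, div_inv_eq_mul, mul_comm]
  calc |a ^ (-q) - J * b ^ (-q)|
      = |(a ^ (-q) - b ^ (-q)) + (1 - J) * b ^ (-q)| := by ring_nf
    _ ≤ |a ^ (-q) - b ^ (-q)| + |1 - J| * b ^ (-q) := by
        refine (abs_add_le _ _).trans_eq ?_
        rw [abs_mul, abs_of_nonneg hb0]
    _ ≤ q * 2 ^ (q + 1) * a ^ (-q - 1) * (a ^ 2 / R) + 6 / R * a * (2 ^ q * a ^ (-q)) := by
        gcongr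
        exact (abs_rpow_neg_sub_le hq ha hb).trans (by gcongr)
    _ = kernelConst q R * a ^ (1 - q) := by
        rw [show 1 - q = -q + 1 by ring, Real.rpow_add_one ha.ne', Real.rpow_sub_one ha.ne',
          kernelConst]
        field_simp

lemma IsTubularNormal.abs_kernel_sub_le {V : Type*} [NormedAddCommGroup V]
    [InnerProductSpace ℝ V] [FiniteDimensional ℝ V] {S : Set V} {R q : ℝ} {x n y : V}
    (hx : IsTubularNormal S R x n) (hq : 0 < q) (hy : y ∈ ball x (R / 24)) :
    |‖y - x‖ ^ (-q) - |(fderiv ℝ (flatten S x n) y).det| * ‖flatten S x n y - x‖ ^ (-q)| ≤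
      kernelConst q R * ‖y - x‖ ^ (1 - q) := by
  have hR := hx.radius_pos
  rcases eq_or_ne y x with rfl | hyx
  · rw [flatten_self, sub_self, norm_zero, Real.zero_rpow (neg_ne_zero.2 hq.ne'), mul_zero,
      sub_zero, abs_zero]
    exact mul_nonneg (kernelConst_nonneg hq hR) (Real.rpow_nonneg le_rfl _)
  refine abs_rpow_neg_sub_mul_rpow_neg_le hq hR (norm_sub_pos_iff.2 hyx) (mem_ball_iff_norm.1 hy)
    ?_ ?_
  · calc |‖y - x‖ - ‖flatten S x n y - x‖| ≤ ‖y - x - (flatten S x n y - x)‖ :=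
          abs_norm_sub_norm_le _ _
      _ = ‖flatten S x n y - y‖ := by rw [sub_sub_sub_cancel_right, norm_sub_rev]
      _ ≤ ‖y - x‖ ^ 2 / R := hx.norm_flatten_sub_le y
  · calc abs (1 - |(fderiv ℝ (flatten S x n) y).det|)
        = abs (|(fderiv ℝ (flatten S x n) y).det| - |1|) := by rw [abs_sub_comm, abs_one]
      _ ≤ |(fderiv ℝ (flatten S x n) y).det - 1| := abs_abs_sub_abs_le_abs_sub _ _
      _ ≤ 6 / R * ‖y - x‖ := hx.abs_det_fderiv_flatten_sub_one_le hy

end Kernel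

section LayerProfile

variable {N : ℕ} {s p d η : ℝ} {x : E N} {G : ℝ → ℝ} {ψ : E N → ℝ}

/-- The growth condition on a function `G` of the signed distance under which its nonlocal operator
at level `d` can be compared with that of the half-space; it is modelled on
`G t = spow (d ^ s - (max t 0) ^ s) (p - 1)`. -/
structure IsLayerProfile (s p d : ℝ) (G : ℝ → ℝ) : Prop where
  measurable : Measurable G
  abs_le : ∀ t, |G t| ≤ |max t 0 - d| ^ (s * (p - 1))

namespace IsLayerProfile

lemma abs_comp_le (hG : IsLayerProfile s p d G) (hs0 : 0 < s) (hp : 1 < p)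
    (hψ : ∀ y, |max (ψ y) 0 - d| ≤ ‖y - x‖) (y : E N) :
    |G (ψ y)| ≤ ‖y - x‖ ^ (s * (p - 1)) :=
  (hG.abs_le _).trans
    (Real.rpow_le_rpow (abs_nonneg _) (hψ y) (mul_nonneg hs0.le (sub_nonneg.2 hp.le)))

lemma comp_self (hG : IsLayerProfile s p d G) (hs0 : 0 < s) (hp : 1 < p)
    (hψ : ∀ y, |max (ψ y) 0 - d| ≤ ‖y - x‖) : G (ψ x) = 0 := by
  have h := hG.abs_comp_le hs0 hp hψ x
  rwa [sub_self, norm_zero, Real.zero_rpow (mul_pos hs0 (sub_pos.2 hp)).ne', abs_nonpos_iff] at h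

lemma measurable_comp_mul (hG : IsLayerProfile s p d G) (hψ : Measurable ψ) (q : ℝ) :
    Measurable fun y => G (ψ y) * ‖y - x‖ ^ (-q) := by
  have := hG.measurable
  fun_prop

lemma norm_comp_mul_le (hG : IsLayerProfile s p d G) (hs0 : 0 < s) (hp : 1 < p)
    (hψ : ∀ y, |max (ψ y) 0 - d| ≤ ‖y - x‖) {C k a b : ℝ} (hC : 0 ≤ C) {y : E N}
    (hk : |k| ≤ C * ‖y - x‖ ^ a) (hab : s * (p - 1) + a = b) :
    ‖G (ψ y) * k‖ ≤ C * ‖y - x‖ ^ b := by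
  rcases eq_or_ne y x with rfl | hyx
  · rw [hG.comp_self hs0 hp hψ, zero_mul, norm_zero]
    positivity
  · rw [norm_mul, Real.norm_eq_abs, Real.norm_eq_abs, ← hab,
      Real.rpow_add (norm_sub_pos_iff.2 hyx), mul_left_comm]
    gcongr
    exact hG.abs_comp_le hs0 hp hψ y

lemma norm_comp_mul_rpow_le (hG : IsLayerProfile s p d G) (hs0 : 0 < s) (hp : 1 < p)
    (hψ : ∀ y, |max (ψ y) 0 - d| ≤ ‖y - x‖) (y : E N) :
    ‖G (ψ y) * ‖y - x‖ ^ (-(N + p * s))‖ ≤ ‖y - x‖ ^ (-s - N) := by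
  refine (hG.norm_comp_mul_le hs0 hp hψ (a := -(N + p * s)) zero_le_one ?_ (by ring)).trans_eq
    (one_mul _)
  rw [abs_of_nonneg (by positivity), one_mul]

lemma integrable_comp_mul (hG : IsLayerProfile s p d G) (hN : 0 < N) (hs0 : 0 < s) (hp : 1 < p)
    (hψ : ∀ y, |max (ψ y) 0 - d| ≤ ‖y - x‖) (hψm : Measurable ψ) (hη : 0 < η)
    (hzero : ∀ t, |max t 0 - d| < η → G t = 0) :
    Integrable (fun y => G (ψ y) * ‖y - x‖ ^ (-(N + p * s))) ∧
      ∫ y, ‖G (ψ y) * ‖y - x‖ ^ (-(N + p * s))‖ ≤ sphereArea (E N) * (η ^ (-s) / s) := by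
  obtain ⟨hint, hval⟩ := integrableOn_and_integral_norm_sub_rpow_compl_ball
    finrank_euclideanSpace_fin hN hs0 hη x
  have hind := hint.integrable_indicator measurableSet_ball.compl
  have hle : ∀ y, ‖G (ψ y) * ‖y - x‖ ^ (-(N + p * s))‖ ≤
      (ball x η)ᶜ.indicator (fun y => ‖y - x‖ ^ (-s - N)) y := by
    intro y
    by_cases hy : y ∈ ball x η
    · rw [hzero _ ((hψ y).trans_lt (mem_ball_iff_norm.1 hy)), zero_mul, norm_zero]
      exact indicator_nonneg (fun _ _ => by positivity) _
    · rw [indicator_of_mem (mem_compl hy)]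
      exact hG.norm_comp_mul_rpow_le hs0 hp hψ y
  have hG_int := hind.mono' (hG.measurable_comp_mul hψm _).aestronglyMeasurable
    (Eventually.of_forall hle)
  refine ⟨hG_int, ?_⟩
  rw [← hval, ← integral_indicator measurableSet_ball.compl]
  exact integral_mono hG_int.norm hind hle

end IsLayerProfile

end LayerProfile

section Comparison

variable {N : ℕ} {S : Set (E N)} {R s p η : ℝ} {x n : E N} {G : ℝ → ℝ}

/-- The signed distance of the half-space with inner normal `n` whose boundary has signed distance
`sdist S x` from `x`; it is what `flatten S x n` turns `sdist S` into. -/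
def tangentSdist (S : Set (E N)) (x n z : E N) : ℝ := sdist S x + inner ℝ n (z - x)

lemma measurable_tangentSdist : Measurable (tangentSdist S x n) := by
  unfold tangentSdist
  fun_prop

lemma abs_max_sdist_sub_le (hx : 0 ≤ sdist S x) (y : E N) :
    |max (sdist S y) 0 - sdist S x| ≤ ‖y - x‖ := by
  have hlip := (lipschitz_infDist_pt Sᶜ).dist_le_mul y x
  rw [← max_sdist_zero, ← max_sdist_zero, max_eq_left hx] at hlip
  rwa [NNReal.coe_one, one_mul, Real.dist_eq, dist_eq_norm] at hlip

lemma abs_max_add_inner_sub_le {d : ℝ} (hd : 0 ≤ d) (hn : ‖n‖ = 1) (z : E N) :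
    |max (d + inner ℝ n z) 0 - d| ≤ ‖z‖ :=
  calc |max (d + inner ℝ n z) 0 - d| = |max (d + inner ℝ n z) 0 - max d 0| := by
        rw [max_eq_left hd]
    _ ≤ |d + inner ℝ n z - d| := abs_max_sub_max_le_abs _ _ _
    _ = |inner ℝ n z| := by rw [add_sub_cancel_left]
    _ ≤ ‖n‖ * ‖z‖ := abs_real_inner_le_norm _ _
    _ = ‖z‖ := by rw [hn, one_mul]

lemma abs_max_tangentSdist_sub_le (hx : 0 ≤ sdist S x) (hn : ‖n‖ = 1) (z : E N) :
    |max (tangentSdist S x n z) 0 - sdist S x| ≤ ‖z - x‖ :=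
  abs_max_add_inner_sub_le hx hn (z - x)

/-- The difference of the nonlocal operators in `S` and in the half-space tangent at the level of
`x`, for a function `G` of the signed distance: near `x` the change of variables `flatten` leaves
only a difference of kernels, and away from `x` the two tails are kept as they are. -/
def comparisonError (S : Set (E N)) (R q : ℝ) (x n : E N) (G : ℝ → ℝ) : ℝ :=
  (∫ y in (ball x (R / 24))ᶜ, G (sdist S y) * ‖y - x‖ ^ (-q)) +
    (∫ y in ball x (R / 24), G (sdist S y) *
      (‖y - x‖ ^ (-q) - |(fderiv ℝ (flatten S x n) y).det| * ‖flatten S x n y - x‖ ^ (-q))) -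
    ∫ z in (flatten S x n '' ball x (R / 24))ᶜ, G (tangentSdist S x n z) * ‖z - x‖ ^ (-q)

/-- The uniform bound for `comparisonError`. -/
def errorConst (N : ℕ) (s p R : ℝ) : ℝ :=
  sphereArea (E N) * ((R / 24) ^ (-s) / s) +
    kernelConst (N + p * s) R * (sphereArea (E N) * ((R / 24) ^ (1 - s) / (1 - s))) +
    sphereArea (E N) * ((R / 48) ^ (-s) / s)

namespace IsTubularNormal

lemma hasFDerivWithinAt_flatten (hx : IsTubularNormal S R x n) :
    ∀ y ∈ ball x (R / 24),
      HasFDerivWithinAt (flatten S x n) (fderiv ℝ (flatten S x n) y) (ball x (R / 24)) y :=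
  fun _ hy => (hx.differentiableAt_flatten hy).hasFDerivAt.hasFDerivWithinAt

lemma norm_comp_mul_kernel_sub_le (hx : IsTubularNormal S R x n) (hs0 : 0 < s) (hp : 1 < p)
    (hx0 : 0 ≤ sdist S x) (hG : IsLayerProfile s p (sdist S x) G) {y : E N}
    (hy : y ∈ ball x (R / 24)) :
    ‖G (sdist S y) * (‖y - x‖ ^ (-(N + p * s)) -
        |(fderiv ℝ (flatten S x n) y).det| * ‖flatten S x n y - x‖ ^ (-(N + p * s)))‖ ≤
      kernelConst (N + p * s) R * ‖y - x‖ ^ (1 - s - N) := by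
  have hq : 0 < N + p * s := by positivity
  exact hG.norm_comp_mul_le hs0 hp (abs_max_sdist_sub_le hx0) (kernelConst_nonneg hq hx.radius_pos)
    (hx.abs_kernel_sub_le hq hy) (by ring)

lemma compl_image_flatten_subset (hx : IsTubularNormal S R x n) :
    (flatten S x n '' ball x (R / 24))ᶜ ⊆ (ball x (R / 48))ᶜ :=
  compl_subset_compl.2 hx.ball_subset_image_flatten

lemma abs_comparisonError_le (hx : IsTubularNormal S R x n) (hN : 0 < N) (hs0 : 0 < s)
    (hs1 : s < 1) (hp : 1 < p) (hx0 : 0 ≤ sdist S x) (hG : IsLayerProfile s p (sdist S x) G) :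
    |comparisonError S R (N + p * s) x n G| ≤ errorConst N s p R := by
  have hR := hx.radius_pos
  have hfin := finrank_euclideanSpace_fin (𝕜 := ℝ) (n := N)
  obtain ⟨hint_far, hval_far⟩ := integrableOn_and_integral_norm_sub_rpow_compl_ball hfin hN hs0
    (by positivity : 0 < R / 24) x
  obtain ⟨hint_near, hval_near⟩ := integrableOn_and_integral_norm_sub_rpow_ball hfin hN
    (sub_pos.2 hs1) (by positivity : 0 < R / 24) x
  obtain ⟨hint_flat, hval_flat⟩ := integrableOn_and_integral_norm_sub_rpow_compl_ball hfin hN hs0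
    (by positivity : 0 < R / 48) x
  have hfar := norm_integral_le_of_norm_le hint_far
    (Eventually.of_forall (hG.norm_comp_mul_rpow_le hs0 hp (abs_max_sdist_sub_le hx0)))
  have hnear := norm_integral_le_of_norm_le (hint_near.const_mul (kernelConst (N + p * s) R))
    (ae_restrict_of_forall_mem measurableSet_ball
      fun y hy => hx.norm_comp_mul_kernel_sub_le hs0 hp hx0 hG hy)
  have hflat := norm_integral_le_of_norm_le (hint_flat.mono_set hx.compl_image_flatten_subset)
    (Eventually.of_forall
      (hG.norm_comp_mul_rpow_le hs0 hp (abs_max_tangentSdist_sub_le hx0 hx.norm_eq_one)))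
  have hflat_mono := setIntegral_mono_set hint_flat
    (Eventually.of_forall fun y => by positivity) hx.compl_image_flatten_subset.eventuallyLE
  rw [hval_far] at hfar
  rw [integral_const_mul, hval_near] at hnear
  rw [hval_flat] at hflat_mono
  exact (abs_sub _ _).trans
    (add_le_add ((abs_add_le _ _).trans (add_le_add hfar hnear)) (hflat.trans hflat_mono))

lemma aemeasurable_kernel (hx : IsTubularNormal S R x n) (q : ℝ) :
    AEMeasurable
      (fun y => |(fderiv ℝ (flatten S x n) y).det| * ‖flatten S x n y - x‖ ^ (-q))
      (volume.restrict (ball x (R / 24))) := by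
  have hdet : AEMeasurable (fun y => |(fderiv ℝ (flatten S x n) y).det|)
      (volume.restrict (ball x (R / 24))) :=
    (aemeasurable_toNNReal_abs_det_fderivWithin volume measurableSet_ball
      hx.hasFDerivWithinAt_flatten).coe_nnreal_real.congr
      (Eventually.of_forall fun y => Real.coe_toNNReal _ (abs_nonneg _))
  have hflatten : AEMeasurable (flatten S x n) (volume.restrict (ball x (R / 24))) :=
    ContinuousOn.aemeasurable
      (fun y hy => (hx.hasFDerivWithinAt_flatten y hy).continuousWithinAt) measurableSet_ball
  fun_prop

lemma measurableSet_image_flatten (hx : IsTubularNormal S R x n) :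
    MeasurableSet (flatten S x n '' ball x (R / 24)) :=
  measurable_image_of_fderivWithin measurableSet_ball hx.hasFDerivWithinAt_flatten hx.injOn_flatten

lemma tendsto_comparisonError (hx : IsTubularNormal S R x n) (hN : 0 < N) (hs0 : 0 < s)
    (hs1 : s < 1) (hp : 1 < p) (hx0 : 0 ≤ sdist S x) {F : ℕ → ℝ → ℝ}
    (hF : ∀ k, IsLayerProfile s p (sdist S x) (F k))
    (hlim : ∀ t, Tendsto (fun k => F k t) atTop (𝓝 (G t))) :
    Tendsto (fun k => comparisonError S R (N + p * s) x n (F k)) atTop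
      (𝓝 (comparisonError S R (N + p * s) x n G)) := by
  have hR := hx.radius_pos
  have hfin := finrank_euclideanSpace_fin (𝕜 := ℝ) (n := N)
  have hsdist := (lipschitzWith_sdist S).continuous.measurable
  have hfar := (integrableOn_and_integral_norm_sub_rpow_compl_ball hfin hN hs0
    (by positivity : 0 < R / 24) x).1
  have hnear := (integrableOn_and_integral_norm_sub_rpow_ball hfin hN (sub_pos.2 hs1)
    (by positivity : 0 < R / 24) x).1
  have hflat := (integrableOn_and_integral_norm_sub_rpow_compl_ball hfin hN hs0
    (by positivity : 0 < R / 48) x).1.mono_set hx.compl_image_flatten_subset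
  have hlim_mul (t k : ℝ) : Tendsto (fun j => F j t * k) atTop (𝓝 (G t * k)) :=
    (hlim t).mul_const k
  refine ((tendsto_integral_of_dominated_convergence _ (fun k => ?_) hfar (fun k => ?_)
    (Eventually.of_forall fun y => hlim_mul _ _)).add
    (tendsto_integral_of_dominated_convergence _ (fun k => ?_)
      (hnear.const_mul (kernelConst (N + p * s) R)) (fun k => ?_)
      (Eventually.of_forall fun y => hlim_mul _ _))).sub
    (tendsto_integral_of_dominated_convergence _ (fun k => ?_) hflat (fun k => ?_)
      (Eventually.of_forall fun y => hlim_mul _ _))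
  · exact ((hF k).measurable_comp_mul hsdist _).aestronglyMeasurable
  · exact Eventually.of_forall ((hF k).norm_comp_mul_rpow_le hs0 hp (abs_max_sdist_sub_le hx0))
  · have hFk := (hF k).measurable
    exact ((hFk.comp hsdist).aemeasurable.mul
      (AEMeasurable.sub (by fun_prop) (hx.aemeasurable_kernel _))).aestronglyMeasurable
  · exact ae_restrict_of_forall_mem measurableSet_ball
      fun y hy => hx.norm_comp_mul_kernel_sub_le hs0 hp hx0 (hF k) hy
  · exact ((hF k).measurable_comp_mul measurable_tangentSdist _).aestronglyMeasurable
  · exact Eventually.of_forall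
      ((hF k).norm_comp_mul_rpow_le hs0 hp (abs_max_tangentSdist_sub_le hx0 hx.norm_eq_one))

lemma integral_comp_sdist_eq (hx : IsTubularNormal S R x n) (hN : 0 < N) (hs0 : 0 < s)
    (hp : 1 < p) (hx0 : 0 ≤ sdist S x) (hG : IsLayerProfile s p (sdist S x) G) (hη : 0 < η)
    (hzero : ∀ t, |max t 0 - sdist S x| < η → G t = 0) :
    ∫ y, G (sdist S y) * ‖y - x‖ ^ (-(N + p * s)) =
      comparisonError S R (N + p * s) x n G +
        ∫ z, G (tangentSdist S x n z) * ‖z - x‖ ^ (-(N + p * s)) := by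
  set q : ℝ := N + p * s
  have hint : Integrable fun y => G (sdist S y) * ‖y - x‖ ^ (-q) :=
    (hG.integrable_comp_mul hN hs0 hp (abs_max_sdist_sub_le hx0)
      (lipschitzWith_sdist S).continuous.measurable hη hzero).1
  have hint_flat : Integrable fun z => G (tangentSdist S x n z) * ‖z - x‖ ^ (-q) :=
    (hG.integrable_comp_mul hN hs0 hp (abs_max_tangentSdist_sub_le hx0 hx.norm_eq_one)
      measurable_tangentSdist hη hzero).1
  have hpull : ∀ y, |(fderiv ℝ (flatten S x n) y).det| •
      (G (tangentSdist S x n (flatten S x n y)) * ‖flatten S x n y - x‖ ^ (-q)) =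
      G (sdist S y) * (|(fderiv ℝ (flatten S x n) y).det| * ‖flatten S x n y - x‖ ^ (-q)) := by
    intro y
    rw [hx.sdist_eq_flatten y, smul_eq_mul, tangentSdist]
    ring
  have hchange := integral_image_eq_integral_abs_det_fderiv_smul volume measurableSet_ball
    hx.hasFDerivWithinAt_flatten hx.injOn_flatten
    fun z => G (tangentSdist S x n z) * ‖z - x‖ ^ (-q)
  have hint_pull := (integrableOn_image_iff_integrableOn_abs_det_fderiv_smul volume
    measurableSet_ball hx.hasFDerivWithinAt_flatten hx.injOn_flatten
    fun z => G (tangentSdist S x n z) * ‖z - x‖ ^ (-q)).1 hint_flat.integrableOn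
  simp_rw [hpull] at hchange hint_pull
  rw [← integral_add_compl (measurableSet_ball (x := x) (ε := R / 24)) hint,
    ← integral_add_compl hx.measurableSet_image_flatten hint_flat, hchange, comparisonError]
  simp_rw [mul_sub]
  rw [integral_sub hint.integrableOn hint_pull]
  ring

end IsTubularNormal

end Comparison

section Truncation

variable {N : ℕ} {Ω : Set (E N)} {R s p κ : ℝ} {x n : E N}

lemma sdist_eq_delta (hx : x ∈ Ω) : sdist Ω x = delta Ω x := sdist_of_mem hx

lemma delta_nonneg (Ω : Set (E N)) (x : E N) : 0 ≤ delta Ω x := infDist_nonneg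

lemma continuous_delta (Ω : Set (E N)) : Continuous (delta Ω) := continuous_infDist_pt _

lemma delta_eq_zero (hx : x ∉ Ω) : delta Ω x = 0 := infDist_zero_of_mem (mem_compl hx)

lemma mem_of_delta_pos (hd : 0 < delta Ω x) : x ∈ Ω :=
  not_imp_comm.1 delta_eq_zero hd.ne'

lemma delta_pos (ho : IsOpen Ω) (hne : Ωᶜ.Nonempty) (hx : x ∈ Ω) : 0 < delta Ω x :=
  (ho.isClosed_compl.notMem_iff_infDist_pos hne).1 (notMem_compl_iff.2 hx)

lemma abs_delta_sub_le (Ω : Set (E N)) (x y : E N) : |delta Ω x - delta Ω y| ≤ ‖x - y‖ := by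
  have hlip := (lipschitz_infDist_pt Ωᶜ).dist_le_mul x y
  rwa [NNReal.coe_one, one_mul, Real.dist_eq, dist_eq_norm] at hlip

/-- The fractional `p`-Laplacian of `δ ^ s` at `x`, up to a factor `2`, truncated by `κ < 1`: the
integral omits the points `y` with `κ δ(x) < δ(y) < κ⁻¹ δ(x)`, a condition which is symmetric in
`x` and `y`. -/
def truncOp (s p κ : ℝ) (Ω : Set (E N)) (x : E N) : ℝ :=
  ∫ y, profile s p κ (delta Ω x) (delta Ω y) / ‖x - y‖ ^ ((N : ℝ) + p * s)

lemma isLayerProfile_profile (hs0 : 0 < s) (hs1 : s < 1) (hp : 1 < p) {d : ℝ} (hd : 0 ≤ d) :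
    IsLayerProfile s p d fun t => profile s p κ d (max t 0) where
  measurable := measurable_profile.comp (by fun_prop : Measurable fun t : ℝ => (d, max t 0))
  abs_le t := by
    rw [abs_sub_comm]
    exact abs_profile_le hs0 hs1 hp hd (le_max_right _ _)

lemma isLayerProfile_spow (hs0 : 0 < s) (hs1 : s < 1) (hp : 1 < p) {d : ℝ} (hd : 0 ≤ d) :
    IsLayerProfile s p d fun t => spow (d ^ s - max t 0 ^ s) (p - 1) where
  measurable := (measurable_spow _).comp (by fun_prop)
  abs_le t := by
    rw [abs_sub_comm]
    exact abs_spow_rpow_sub_le hs0 hs1 hp hd (le_max_right _ _)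

lemma profile_eq_zero_of_abs_max_sub_lt (hκ0 : 0 < κ) (hκ1 : κ < 1) {d : ℝ} (t : ℝ)
    (ht : |max t 0 - d| < (1 - κ) * d) : profile s p κ d (max t 0) = 0 :=
  profile_eq_zero hκ0 hκ1 (by rwa [abs_sub_comm])

lemma profile_delta_div_eq (hx : x ∈ Ω) (y : E N) :
    profile s p κ (delta Ω x) (delta Ω y) / ‖x - y‖ ^ ((N : ℝ) + p * s) =
      profile s p κ (sdist Ω x) (max (sdist Ω y) 0) * ‖y - x‖ ^ (-(N + p * s)) := by
  rw [max_sdist_zero, sdist_eq_delta hx, norm_sub_rev, Real.rpow_neg (norm_nonneg _),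
    div_eq_mul_inv, delta, delta]

lemma integrable_profile_delta (hN : 0 < N) (hs0 : 0 < s) (hs1 : s < 1) (hp : 1 < p)
    (hκ0 : 0 < κ) (hκ1 : κ < 1) (hd : 0 < delta Ω x) :
    Integrable (fun y => profile s p κ (delta Ω x) (delta Ω y) / ‖x - y‖ ^ ((N : ℝ) + p * s)) ∧
      ∫ y, ‖profile s p κ (delta Ω x) (delta Ω y) / ‖x - y‖ ^ ((N : ℝ) + p * s)‖ ≤
        sphereArea (E N) * (((1 - κ) * delta Ω x) ^ (-s) / s) := by
  have hx := mem_of_delta_pos hd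
  simp_rw [profile_delta_div_eq hx]
  rw [← sdist_eq_delta hx] at hd ⊢
  exact (isLayerProfile_profile hs0 hs1 hp hd.le).integrable_comp_mul hN hs0 hp
    (abs_max_sdist_sub_le hd.le) (lipschitzWith_sdist Ω).continuous.measurable
    (mul_pos (sub_pos.2 hκ1) hd) (profile_eq_zero_of_abs_max_sub_lt hκ0 hκ1)

lemma integral_profile_halfSpace (hN : 0 < N) (hs0 : 0 < s) (hs1 : s < 1) (hp : 1 < p)
    (hκ0 : 0 < κ) (hκ1 : κ < 1) {d : ℝ} (hd : 0 < d) (hn : ‖n‖ = 1) :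
    ∫ z : E N, profile s p κ d (max (d + inner ℝ n z) 0) * ‖z‖ ^ (-(N + p * s)) =
      layerConst (N - 1) (N + p * s) * (d ^ (-s) * (profileDefect s p κ / (p * s))) := by
  have hps : 0 < p * s := by positivity
  obtain ⟨hint_line, hval_line⟩ := integrable_and_integral_profile hs0 hp hκ0 hκ1 hd
  have hG := isLayerProfile_profile (κ := κ) hs0 hs1 hp hd.le
  obtain ⟨hint, -⟩ := hG.integrable_comp_mul (x := 0) hN hs0 hp
    (fun z => (abs_max_add_inner_sub_le hd.le hn z).trans_eq (by rw [sub_zero])) (by fun_prop)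
    (mul_pos (sub_pos.2 hκ1) hd) (profile_eq_zero_of_abs_max_sub_lt hκ0 hκ1)
  simp only [sub_zero] at hint
  obtain ⟨m, rfl⟩ := Nat.exists_eq_succ_of_ne_zero hN.ne'
  have hexp : (m : ℝ) - ((m + 1 : ℕ) + p * s) = -1 - p * s := by
    push_cast
    ring
  rw [integral_inner_mul_norm_rpow (m := m) (by push_cast; linarith) hn
    (g := fun t => profile s p κ d (max (d + t) 0))
    (hG.measurable.comp (measurable_const_add d)) hint (by rwa [hexp]), hexp, hval_line,
    Nat.succ_sub_one]

lemma truncOp_eq (hN : 0 < N) (hs0 : 0 < s) (hs1 : s < 1) (hp : 1 < p)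
    (hκ0 : 0 < κ) (hκ1 : κ < 1) (hd : 0 < delta Ω x)
    (hn : IsTubularNormal Ω R x n) :
    truncOp s p κ Ω x =
      comparisonError Ω R (N + p * s) x n (fun t => profile s p κ (delta Ω x) (max t 0)) +
      layerConst (N - 1) (N + p * s) * (delta Ω x ^ (-s) * (profileDefect s p κ / (p * s))) := by
  have hx := mem_of_delta_pos hd
  rw [truncOp]
  simp_rw [profile_delta_div_eq hx]
  rw [← sdist_eq_delta hx] at hd ⊢
  rw [hn.integral_comp_sdist_eq hN hs0 hp hd.le (isLayerProfile_profile hs0 hs1 hp hd.le)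
    (mul_pos (sub_pos.2 hκ1) hd) (profile_eq_zero_of_abs_max_sub_lt hκ0 hκ1),
    ← integral_profile_halfSpace hN hs0 hs1 hp hκ0 hκ1 hd hn.norm_eq_one]
  congr 1
  exact integral_sub_right_eq_self
    (fun z => profile s p κ (sdist Ω x) (max (sdist Ω x + inner ℝ n z) 0) *
      ‖z‖ ^ (-(N + p * s))) x

lemma abs_truncOp_le (hN : 0 < N) (hs0 : 0 < s) (hs1 : s < 1) (hp : 1 < p)
    (hκ0 : 0 < κ) (hκ1 : κ < 1) (hd : 0 < delta Ω x)
    (hn : IsTubularNormal Ω R x n) :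
    |truncOp s p κ Ω x| ≤
      errorConst N s p R + layerConst (N - 1) (N + p * s) / (p * s) * delta Ω x ^ (-s) := by
  have hdefect := profileDefect_nonneg (p := p) hs0 hκ0 hκ1
  have hdefect_le := profileDefect_le_one hs0 hs1 hp hκ0 hκ1
  have hlayer := layerConst_nonneg (N - 1) (N + p * s)
  rw [truncOp_eq hN hs0 hs1 hp hκ0 hκ1 hd hn]
  refine (abs_add_le _ _).trans (add_le_add ?_ ?_)
  · have hx := mem_of_delta_pos hd
    rw [← sdist_eq_delta hx] at hd ⊢
    exact hn.abs_comparisonError_le hN hs0 hs1 hp hd.le (isLayerProfile_profile hs0 hs1 hp hd.le)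
  · rw [abs_of_nonneg (by positivity)]
    calc layerConst (N - 1) (N + p * s) * (delta Ω x ^ (-s) * (profileDefect s p κ / (p * s)))
        ≤ layerConst (N - 1) (N + p * s) * (delta Ω x ^ (-s) * (1 / (p * s))) := by gcongr
      _ = layerConst (N - 1) (N + p * s) / (p * s) * delta Ω x ^ (-s) := by ring

lemma exists_tendsto_truncOp (hN : 0 < N) (hs0 : 0 < s) (hs1 : s < 1) (hp : 1 < p)
    {κ : ℕ → ℝ} (hκ0 : ∀ k, 0 < κ k) (hκ1 : ∀ k, κ k < 1) (hκ : Tendsto κ atTop (𝓝 1))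
    (hd : 0 < delta Ω x) (hn : IsTubularNormal Ω R x n) :
    ∃ L, |L| ≤ errorConst N s p R ∧ Tendsto (fun k => truncOp s p (κ k) Ω x) atTop (𝓝 L) := by
  have hsd := sdist_eq_delta (mem_of_delta_pos hd)
  have hprofile (k : ℕ) :
      IsLayerProfile s p (sdist Ω x) fun t => profile s p (κ k) (delta Ω x) (max t 0) := by
    rw [hsd]
    exact isLayerProfile_profile hs0 hs1 hp hd.le
  have hspow :
      IsLayerProfile s p (sdist Ω x) fun t => spow (delta Ω x ^ s - max t 0 ^ s) (p - 1) := by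
    rw [hsd]
    exact isLayerProfile_spow hs0 hs1 hp hd.le
  have hx0 : 0 ≤ sdist Ω x := hsd ▸ hd.le
  refine ⟨_, hn.abs_comparisonError_le hN hs0 hs1 hp hx0 hspow, ?_⟩
  have hlayer := ((((tendsto_profileDefect hs0 hs1 hp hκ0 hκ1 hκ).div_const (p * s)).const_mul
    (delta Ω x ^ (-s))).const_mul (layerConst (N - 1) (N + p * s)))
  rw [zero_div, mul_zero, mul_zero] at hlayer
  have hlim := (hn.tendsto_comparisonError hN hs0 hs1 hp hx0 hprofile
    fun t => tendsto_profile _ _ hκ).add hlayer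
  rw [add_zero] at hlim
  exact hlim.congr fun k => (truncOp_eq hN hs0 hs1 hp (hκ0 k) (hκ1 k) hd hn).symm

lemma measurable_profile_delta (Ω : Set (E N)) :
    Measurable fun z : E N × E N =>
      profile s p κ (delta Ω z.1) (delta Ω z.2) / ‖z.1 - z.2‖ ^ ((N : ℝ) + p * s) := by
  have hdelta := (continuous_delta Ω).measurable
  exact (measurable_profile.comp
    (by fun_prop : Measurable fun z : E N × E N => (delta Ω z.1, delta Ω z.2))).div (by fun_prop)

lemma stronglyMeasurable_truncOp (Ω : Set (E N)) : StronglyMeasurable (truncOp s p κ Ω) :=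
  (measurable_profile_delta Ω).stronglyMeasurable.integral_prod_right

end Truncation

section BoundaryIntegrability

variable {N m : ℕ} {Ω S : Set (E N)} {a q r R : ℝ} {x n : E N}

lemma setLIntegral_inner_sub_le (hq : m < q) {n : E (m + 1)} (hn : ‖n‖ = 1) {g : ℝ → ℝ≥0∞}
    (hg : Measurable g) (x : E (m + 1)) :
    ∫⁻ z in ball x r, g (inner ℝ n (z - x)) ≤
      ENNReal.ofReal (r ^ q) * (ENNReal.ofReal (layerConst m q) *
        ∫⁻ t in Ioo (-r) r, g t * ENNReal.ofReal (|t| ^ (m - q))) := by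
  have hq0 : 0 < q := m.cast_nonneg.trans_lt hq
  set G := (Ioo (-r) r).indicator g with hG
  have hGm : Measurable G := hg.indicator measurableSet_Ioo
  have hpointwise : ∀ᵐ z, (ball x r).indicator (fun z => g (inner ℝ n (z - x))) z ≤
      ENNReal.ofReal (r ^ q) * (G (inner ℝ n (z - x)) * ENNReal.ofReal (‖z - x‖ ^ (-q))) := by
    filter_upwards [compl_mem_ae_iff.2 (measure_singleton x)] with z hzx
    by_cases hz : z ∈ ball x r
    swap
    · exact (indicator_of_notMem hz _).trans_le zero_le
    rw [indicator_of_mem hz]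
    rw [mem_ball_iff_norm] at hz
    have hzx_pos : 0 < ‖z - x‖ := norm_pos_iff.2 (sub_ne_zero.2 hzx)
    have hr : 0 < r := hzx_pos.trans hz
    have hinner : inner ℝ n (z - x) ∈ Ioo (-r) r :=
      abs_lt.1 ((abs_real_inner_le_norm n (z - x)).trans_lt (by rwa [hn, one_mul]))
    rw [hG, indicator_of_mem hinner, mul_left_comm, ← ENNReal.ofReal_mul (by positivity)]
    refine le_mul_of_one_le_right zero_le (ENNReal.one_le_ofReal.2 ?_)
    rw [Real.rpow_neg hzx_pos.le, ← div_eq_mul_inv, one_le_div (by positivity)]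
    gcongr
  calc ∫⁻ z in ball x r, g (inner ℝ n (z - x))
    _ = ∫⁻ z, (ball x r).indicator (fun z => g (inner ℝ n (z - x))) z :=
        (lintegral_indicator measurableSet_ball _).symm
    _ ≤ ∫⁻ z, ENNReal.ofReal (r ^ q) *
          (G (inner ℝ n (z - x)) * ENNReal.ofReal (‖z - x‖ ^ (-q))) := lintegral_mono_ae hpointwise
    _ = ENNReal.ofReal (r ^ q) * ∫⁻ z, G (inner ℝ n z) * ENNReal.ofReal (‖z‖ ^ (-q)) := by
        rw [lintegral_const_mul _ (by fun_prop), lintegral_sub_right_eq_self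
          (fun z => G (inner ℝ n z) * ENNReal.ofReal (‖z‖ ^ (-q))) x]
    _ = _ := by
        rw [lintegral_inner_mul_norm_rpow hq hn hGm, ← lintegral_indicator measurableSet_Ioo]
        simp only [hG, indicator_mul_left]

lemma lintegral_abs_rpow_Ioo_lt_top (ha : -1 < a) (hr : 0 < r) :
    ∫⁻ t in Ioo (-r) r, ENNReal.ofReal (|t| ^ a) < ∞ := by
  have hint := (integrableOn_and_integral_norm_sub_rpow_ball (Module.finrank_self ℝ) one_pos
    (by linarith : 0 < a + 1) hr 0).1
  simp only [sub_zero, Nat.cast_one, add_sub_cancel_right, Real.norm_eq_abs] at hint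
  rw [Real.ball_eq_Ioo, zero_sub, zero_add] at hint
  exact hint.lintegral_lt_top

lemma lintegral_abs_inner_rpow_ball_lt_top (hN : 0 < N) (ha1 : a < 1)
    (hr : 0 < r) (hn : ‖n‖ = 1) (x : E N) :
    ∫⁻ z in ball x r, ENNReal.ofReal (|inner ℝ n (z - x)| ^ (-a)) < ∞ := by
  obtain ⟨m, rfl⟩ : ∃ m, N = m + 1 := ⟨N - 1, by omega⟩
  refine (setLIntegral_inner_sub_le (q := m + (1 - a) / 2) (by linarith) hn
    (g := fun t => ENNReal.ofReal (|t| ^ (-a))) (by fun_prop) x).trans_lt ?_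
  refine ENNReal.mul_lt_top ENNReal.ofReal_lt_top (ENNReal.mul_lt_top ENNReal.ofReal_lt_top ?_)
  refine lt_of_le_of_lt (lintegral_mono fun t => ?_)
    (lintegral_abs_rpow_Ioo_lt_top (a := -(1 + a) / 2) (by linarith) hr)
  rw [← ENNReal.ofReal_mul (by positivity)]
  refine ENNReal.ofReal_le_ofReal ((Real.le_rpow_add (abs_nonneg t) _ _).trans_eq ?_)
  congr 1
  ring

lemma IsTubularNormal.lintegral_abs_sdist_rpow_lt_top (hn : IsTubularNormal S R x n)
    (hN : 0 < N) (hx : sdist S x = 0) (ha1 : a < 1) :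
    ∫⁻ y in ball x (R / 24), ENNReal.ofReal (|sdist S y| ^ (-a)) < ∞ := by
  have himage : ∫⁻ z in flatten S x n '' ball x (R / 24),
      ENNReal.ofReal (|inner ℝ n (z - x)| ^ (-a)) < ∞ :=
    (lintegral_mono_set hn.image_flatten_subset_ball).trans_lt
      (lintegral_abs_inner_rpow_ball_lt_top hN ha1 (div_pos hn.radius_pos (by norm_num))
        hn.norm_eq_one x)
  rw [lintegral_image_eq_lintegral_abs_det_fderiv_mul volume measurableSet_ball
    hn.hasFDerivWithinAt_flatten hn.injOn_flatten] at himage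
  refine lt_of_le_of_lt ?_ (ENNReal.mul_lt_top (ENNReal.ofReal_lt_top (r := 2)) himage)
  rw [← lintegral_const_mul' _ _ ENNReal.ofReal_ne_top]
  refine setLIntegral_mono' measurableSet_ball fun y hy => ?_
  rw [hn.sdist_eq_flatten y, hx, zero_add, ← mul_assoc, ← ENNReal.ofReal_mul two_pos.le]
  exact le_mul_of_one_le_left zero_le
    (ENNReal.one_le_ofReal.2 (hn.one_le_two_mul_abs_det_fderiv_flatten hy))

lemma lintegral_delta_rpow_ball_lt_top (hd : 0 < delta Ω x) (ha : 0 ≤ a) :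
    ∫⁻ y in ball x (delta Ω x / 2), ENNReal.ofReal (delta Ω y ^ (-a)) < ∞ := by
  refine (setLIntegral_mono' measurableSet_ball
    (g := fun _ => ENNReal.ofReal ((delta Ω x / 2) ^ (-a))) fun y hy => ?_).trans_lt ?_
  · rw [mem_ball_iff_norm] at hy
    have hdelta := (abs_le.1 (abs_delta_sub_le Ω y x)).1
    exact ENNReal.ofReal_le_ofReal
      (Real.rpow_le_rpow_of_nonpos (by positivity) (by linarith) (by linarith))
  · rw [setLIntegral_const]
    exact ENNReal.mul_lt_top ENNReal.ofReal_lt_top measure_ball_lt_top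

lemma nonempty_compl_of_isBounded (hN : 0 < N) (hb : Bornology.IsBounded Ω) : Ωᶜ.Nonempty := by
  have : Nonempty (Fin N) := ⟨⟨0, hN⟩⟩
  rw [nonempty_compl]
  rintro rfl
  exact NormedSpace.unbounded_univ ℝ (E N) hb

lemma TwoBall.exists_nhds_lintegral_delta_rpow_lt_top (hT : TwoBall R Ω) (hN : 0 < N)
    (hR : 0 < R) (ho : IsOpen Ω) (hne : Ωᶜ.Nonempty) (ha0 : 0 < a) (ha1 : a < 1)
    (hx : x ∈ closure Ω) :
    ∃ U ∈ 𝓝 x, ∫⁻ y in U ∩ Ω, ENNReal.ofReal (delta Ω y ^ (-a)) < ∞ := by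
  by_cases hxΩ : x ∈ Ω
  · have hd := delta_pos ho hne hxΩ
    exact ⟨ball x (delta Ω x / 2), ball_mem_nhds _ (by positivity),
      (lintegral_mono_set inter_subset_left).trans_lt
        (lintegral_delta_rpow_ball_lt_top hd ha0.le)⟩
  · have hx0 : sdist Ω x = 0 := by
      rw [sdist_of_notMem hxΩ, neg_eq_zero, ← infDist_closure]
      exact infDist_zero_of_mem hx
    obtain ⟨n, hn⟩ := hT.exists_isTubularNormal hR (closure_nonempty_iff.1 ⟨x, hx⟩) hne (x := x)
      (by rw [hx0, abs_zero]; positivity)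
    refine ⟨ball x (R / 24), ball_mem_nhds _ (by positivity),
      lt_of_le_of_lt ?_ (hn.lintegral_abs_sdist_rpow_lt_top hN hx0 ha1)⟩
    refine (setLIntegral_mono' (measurableSet_ball.inter ho.measurableSet)
      fun y hy => ?_).trans (lintegral_mono_set inter_subset_left)
    rw [sdist_eq_delta hy.2, abs_of_nonneg (delta_nonneg _ _)]

lemma TwoBall.lintegral_delta_rpow_lt_top (hT : TwoBall R Ω) (hN : 0 < N) (hR : 0 < R)
    (ho : IsOpen Ω) (hb : Bornology.IsBounded Ω) (ha0 : 0 < a) (ha1 : a < 1) :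
    ∫⁻ y in Ω, ENNReal.ofReal (delta Ω y ^ (-a)) < ∞ := by
  suffices H : ∫⁻ y in closure Ω ∩ Ω, ENNReal.ofReal (delta Ω y ^ (-a)) < ∞ by
    rwa [inter_eq_right.2 subset_closure] at H
  refine hb.isCompact_closure.induction_on
    (p := fun t => ∫⁻ y in t ∩ Ω, ENNReal.ofReal (delta Ω y ^ (-a)) < ∞) (by simp) ?_ ?_ ?_
  · intro t t' htt' h
    exact (lintegral_mono_set (inter_subset_inter_left _ htt')).trans_lt h
  · intro t t' h h'
    rw [union_inter_distrib_right]
    exact (lintegral_union_le _ _ _).trans_lt (ENNReal.add_lt_top.2 ⟨h, h'⟩)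
  · intro x hx
    obtain ⟨U, hU, hfin⟩ := hT.exists_nhds_lintegral_delta_rpow_lt_top hN hR ho
      (nonempty_compl_of_isBounded hN hb) ha0 ha1 hx
    exact ⟨U, mem_nhdsWithin_of_mem_nhds hU, hfin⟩

end BoundaryIntegrability

section Hardy

variable {N : ℕ} {Ω U : Set (E N)} {R s p : ℝ} {φ : E N → ℝ}

lemma MemW0.aestronglyMeasurable (hφ : MemW0 s p U φ) : AEStronglyMeasurable φ := by
  simpa only [Measure.restrict_univ] using hφ.1.1.aestronglyMeasurable

/-- The density of the Gagliardo seminorm of `u`. -/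
def gagliardoDensity (s p : ℝ) (u : E N → ℝ) (x y : E N) : ℝ :=
  |u x - u y| ^ p / ‖x - y‖ ^ ((N : ℝ) + p * s)

lemma gagliardoDensity_nonneg (u : E N → ℝ) (x y : E N) : 0 ≤ gagliardoDensity s p u x y :=
  div_nonneg (by positivity) (by positivity)

lemma gagliardoDensity_swap (u : E N → ℝ) (x y : E N) :
    gagliardoDensity s p u x y = gagliardoDensity s p u y x := by
  rw [gagliardoDensity, abs_sub_comm, norm_sub_rev, gagliardoDensity]

lemma aemeasurable_gagliardoDensity {u : E N → ℝ} (hu : AEStronglyMeasurable u) :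
    AEMeasurable fun z : E N × E N => gagliardoDensity s p u z.1 z.2 := by
  unfold gagliardoDensity
  have : AEMeasurable (fun z : E N × E N => u z.1) := hu.aemeasurable.comp_fst
  have : AEMeasurable (fun z : E N × E N => u z.2) := hu.aemeasurable.comp_snd
  fun_prop

lemma gagliardo_univ_eq {u : E N → ℝ} (hu : AEStronglyMeasurable u) :
    gagliardo s p univ u =
      ∫⁻ x, ∫⁻ y, ENNReal.ofReal (gagliardoDensity s p u x y) := by
  rw [gagliardo, univ_prod_univ, Measure.restrict_univ, Measure.volume_eq_prod]
  exact lintegral_prod _ (aemeasurable_gagliardoDensity hu).ennreal_ofReal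

lemma TwoBall.exists_ball_subset_compl (hT : TwoBall R Ω) (hne : Ωᶜ.Nonempty) {x : E N}
    (hx : x ∈ Ω) (hd : delta Ω x ≤ R) :
    ∃ c, ball c (delta Ω x) ⊆ Ωᶜ ∧ ball c (delta Ω x) ⊆ closedBall x (3 * delta Ω x) := by
  obtain ⟨z, hz, hxz⟩ := exists_mem_frontier_infDist_compl_eq_dist hx (nonempty_compl.1 hne)
  obtain ⟨n, hn, -, hout⟩ := (hT z hz).mono hd
  refine ⟨_, hout, fun y hy => ?_⟩
  have hcz : dist (z - delta Ω x • n) z = delta Ω x := by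
    rw [dist_self_sub_left, norm_smul, hn, mul_one, Real.norm_of_nonneg (delta_nonneg _ _)]
  have hzx : dist z x = delta Ω x := by rw [dist_comm, ← hxz, delta]
  rw [mem_ball] at hy
  rw [mem_closedBall]
  linarith [dist_triangle4 y (z - delta Ω x • n) z x]

/-- The constant in Hardy's inequality. -/
def hardyConst (N : ℕ) (s p : ℝ) : ℝ≥0∞ :=
  ENNReal.ofReal (3 ^ (-((N : ℝ) + p * s))) * volume (ball (0 : E N) 1)

lemma hardyConst_ne_zero : hardyConst N s p ≠ 0 := by
  refine mul_ne_zero ?_ (measure_ball_pos volume _ one_pos).ne'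
  rw [ENNReal.ofReal_ne_zero_iff]
  positivity

lemma hardyConst_ne_top : hardyConst N s p ≠ ∞ :=
  ENNReal.mul_ne_top ENNReal.ofReal_ne_top measure_ball_lt_top.ne

lemma hardyConst_mul_eq_setLIntegral {d A : ℝ} (hd : 0 < d) (hA : 0 ≤ A) (c : E N) :
    hardyConst N s p * ENNReal.ofReal ((d ^ (-s) * A) ^ p) =
      ∫⁻ _ in ball c d, ENNReal.ofReal (A ^ p / (3 * d) ^ ((N : ℝ) + p * s)) := by
  rw [setLIntegral_const, Measure.addHaar_ball_of_pos _ _ hd, finrank_euclideanSpace_fin,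
    hardyConst, mul_right_comm, ← mul_assoc, ← ENNReal.ofReal_mul (by positivity),
    ← ENNReal.ofReal_mul (by positivity)]
  congr 2
  rw [Real.mul_rpow (by positivity) hA, ← Real.rpow_mul hd.le, Real.mul_rpow (by norm_num) hd.le,
    Real.rpow_neg (by norm_num), Real.rpow_add hd, Real.rpow_natCast,
    show -s * p = -(p * s) by ring, Real.rpow_neg hd.le]
  field_simp

lemma hardyConst_mul_le_lintegral (hq : 0 ≤ N + p * s) (hφ : ∀ᵐ y, y ∉ U → φ y = 0)
    {c x : E N} {d : ℝ} (hd : 0 < d) (hx : x ∈ U) (hcU : ball c d ⊆ Uᶜ)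
    (hcx : ball c d ⊆ closedBall x (3 * d)) :
    hardyConst N s p * ENNReal.ofReal ((d ^ (-s) * |φ x|) ^ p) ≤
      ∫⁻ y, ENNReal.ofReal (gagliardoDensity s p φ x y) := by
  rw [hardyConst_mul_eq_setLIntegral hd (abs_nonneg _) c]
  refine (setLIntegral_mono_ae' measurableSet_ball ?_).trans (setLIntegral_le_lintegral _ _)
  filter_upwards [hφ] with y hy hyc
  have hxy : 0 < ‖x - y‖ := norm_sub_pos_iff.2 fun h => hcU hyc (h ▸ hx)
  have hxy_le : ‖x - y‖ ≤ 3 * d := by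
    rw [norm_sub_rev]
    exact mem_closedBall_iff_norm.1 (hcx hyc)
  rw [gagliardoDensity, hy (hcU hyc), sub_zero]
  gcongr

lemma TwoBall.hardy (hT : TwoBall R Ω) (hq : 0 ≤ N + p * s) (ho : IsOpen Ω) (hne : Ωᶜ.Nonempty)
    (hUm : MeasurableSet U) (hU : U ⊆ Ω) (hUR : ∀ x ∈ U, delta Ω x ≤ R) (hφ : MemW0 s p U φ) :
    ∫⁻ x in U, ENNReal.ofReal ((delta Ω x ^ (-s) * |φ x|) ^ p) < ∞ := by
  have hfin := hφ.1.2
  rw [gagliardo_univ_eq hφ.aestronglyMeasurable] at hfin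
  have hpointwise (x) (hx : x ∈ U) :
      hardyConst N s p * ENNReal.ofReal ((delta Ω x ^ (-s) * |φ x|) ^ p) ≤
        ∫⁻ y, ENNReal.ofReal (gagliardoDensity s p φ x y) := by
    obtain ⟨c, hcΩ, hcx⟩ := hT.exists_ball_subset_compl hne (hU hx) (hUR x hx)
    exact hardyConst_mul_le_lintegral hq hφ.2 (delta_pos ho hne (hU hx)) hx
      (hcΩ.trans (compl_subset_compl.2 hU)) hcx
  refine ENNReal.lt_top_of_mul_ne_top_right (a := hardyConst N s p) ?_ hardyConst_ne_zero
  rw [← lintegral_const_mul' _ _ hardyConst_ne_top]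
  exact (((setLIntegral_mono' hUm hpointwise).trans
    (setLIntegral_le_lintegral _ _)).trans_lt hfin).ne

lemma TwoBall.integrableOn_delta_rpow_mul (hT : TwoBall R Ω) (hN : 0 < N) (hs0 : 0 < s)
    (hp : 1 < p) (ho : IsOpen Ω) (hb : Bornology.IsBounded Ω)
    (hUm : MeasurableSet U) (hU : U ⊆ Ω) (hUR : ∀ x ∈ U, delta Ω x ≤ R)
    (hφ : MemW0 s p U φ) :
    IntegrableOn (fun x => delta Ω x ^ (-s) * |φ x|) U := by
  have hmeas : AEMeasurable (fun x => delta Ω x ^ (-s) * |φ x|) := by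
    have := hφ.aestronglyMeasurable.aemeasurable
    have := (continuous_delta Ω).measurable
    fun_prop
  have : IsFiniteMeasure (volume.restrict U) :=
    isFiniteMeasure_restrict.2 (hb.subset hU).measure_lt_top.ne
  have hLp : MemLp (fun x => delta Ω x ^ (-s) * |φ x|) (ENNReal.ofReal p) (volume.restrict U) := by
    refine ⟨hmeas.aestronglyMeasurable.restrict, ?_⟩
    rw [eLpNorm_lt_top_iff_lintegral_rpow_enorm_lt_top
      (ENNReal.ofReal_ne_zero_iff.2 (by linarith)) ENNReal.ofReal_ne_top,
      ENNReal.toReal_ofReal (by positivity)]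
    convert hT.hardy (by positivity) ho (nonempty_compl_of_isBounded hN hb) hUm hU hUR hφ with x
    have := delta_nonneg Ω x
    rw [Real.enorm_of_nonneg (by positivity), ENNReal.ofReal_rpow_of_nonneg (by positivity)
      (by positivity)]
  exact hLp.integrable (by simpa using hp.le)

end Hardy

section Energy

variable {N : ℕ} {Ω : Set (E N)} {R s p : ℝ} {u : E N → ℝ}

lemma exists_delta_le (hN : 0 < N) (hb : Bornology.IsBounded Ω) :
    ∃ Δ : ℝ, ∀ x, delta Ω x ≤ Δ := by
  obtain ⟨y, hy⟩ := nonempty_compl_of_isBounded hN hb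
  obtain ⟨r, hr⟩ := hb.subset_ball y
  refine ⟨max r 0, fun x => ?_⟩
  by_cases hx : x ∈ Ω
  · exact (infDist_le_dist_of_mem hy).trans ((hr hx).le.trans (le_max_left _ _))
  · exact (delta_eq_zero hx).trans_le (le_max_right _ _)

lemma abs_rpow_sub_rpow_le_mul {a b c : ℝ} (hs0 : 0 < s) (hs1 : s < 1) (hc : 0 < c) (ha : c ≤ a)
    (hb : c ≤ b) : |a ^ s - b ^ s| ≤ c ^ (s - 1) * |a - b| := by
  refine Convex.norm_image_sub_le_of_norm_hasDerivWithin_le (f := fun t : ℝ => t ^ s)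
    (f' := fun t => s * t ^ (s - 1)) (fun t ht => ?_) (fun t ht => ?_) (convex_Ici c) hb ha
  · exact (Real.hasDerivAt_rpow_const (Or.inl (hc.trans_le ht).ne')).hasDerivWithinAt
  · have ht0 : 0 < t := hc.trans_le ht
    rw [norm_mul, Real.norm_of_nonneg hs0.le, Real.norm_of_nonneg (by positivity)]
    calc s * t ^ (s - 1) ≤ 1 * c ^ (s - 1) :=
          mul_le_mul hs1.le (Real.rpow_le_rpow_of_nonpos hc ht (by linarith)) (by positivity)
            zero_le_one
      _ = c ^ (s - 1) := one_mul _

lemma gagliardoDensity_delta_rpow_le_near (hs0 : 0 < s) (hs1 : s < 1) (hp : 1 < p) {x y : E N}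
    (hd : 0 < delta Ω x) (hy : y ∈ ball x (delta Ω x / 2)) :
    gagliardoDensity s p (fun x => delta Ω x ^ s) x y ≤
      (delta Ω x / 2) ^ (-(p * (1 - s))) * ‖y - x‖ ^ (p * (1 - s) - N) := by
  set d := delta Ω x with hdx
  rw [mem_ball_iff_norm] at hy
  have hdy : d / 2 ≤ delta Ω y := by linarith [(abs_le.1 (abs_delta_sub_le Ω y x)).1]
  have hlip : |d ^ s - delta Ω y ^ s| ≤ (d / 2) ^ (s - 1) * ‖y - x‖ := by
    refine (abs_rpow_sub_rpow_le_mul hs0 hs1 (half_pos hd) (half_le_self hd.le) hdy).trans ?_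
    rw [norm_sub_rev]
    gcongr
    exact abs_delta_sub_le Ω x y
  rw [gagliardoDensity, norm_sub_rev x y]
  rcases (norm_nonneg (y - x)).eq_or_lt with hyx | hyx
  · rw [eq_of_norm_sub_eq_zero hyx.symm, ← hdx, sub_self, abs_zero, Real.zero_rpow (by linarith),
      zero_div]
    positivity
  · calc |d ^ s - delta Ω y ^ s| ^ p / ‖y - x‖ ^ ((N : ℝ) + p * s)
      _ ≤ ((d / 2) ^ (s - 1) * ‖y - x‖) ^ p / ‖y - x‖ ^ ((N : ℝ) + p * s) := by gcongr
      _ = (d / 2) ^ (-(p * (1 - s))) * ‖y - x‖ ^ (p * (1 - s) - N) := by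
        rw [Real.mul_rpow (by positivity) hyx.le, ← Real.rpow_mul (by positivity), mul_div_assoc,
          ← Real.rpow_sub hyx]
        congr 2 <;> ring

lemma lintegral_gagliardoDensity_delta_rpow_near (hN : 0 < N) (hs0 : 0 < s) (hs1 : s < 1)
    (hp : 1 < p) {x : E N} (hd : 0 < delta Ω x) :
    ∫⁻ y in ball x (delta Ω x / 2),
        ENNReal.ofReal (gagliardoDensity s p (fun x => delta Ω x ^ s) x y) ≤
      ENNReal.ofReal (sphereArea (E N) * (1 / (p * (1 - s)))) := by
  have he : 0 < p * (1 - s) := mul_pos (by linarith) (by linarith)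
  obtain ⟨hint, hval⟩ := integrableOn_and_integral_norm_sub_rpow_ball
    (finrank_euclideanSpace_fin (𝕜 := ℝ)) hN he (half_pos hd) x
  refine (setLIntegral_mono' measurableSet_ball fun y hy => ENNReal.ofReal_le_ofReal
    (gagliardoDensity_delta_rpow_le_near hs0 hs1 hp hd hy)).trans ?_
  rw [← ofReal_integral_eq_lintegral_ofReal (hint.const_mul _)
    (Eventually.of_forall fun y => by positivity), integral_const_mul, hval]
  refine ENNReal.ofReal_le_ofReal (le_of_eq ?_)
  rw [Real.rpow_neg (by positivity)]
  have : 0 < (delta Ω x / 2) ^ (p * (1 - s)) := by positivity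
  field_simp

lemma gagliardoDensity_delta_rpow_le_far {Δ a : ℝ} (hs0 : 0 < s) (hs1 : s < 1) (hp : 1 < p)
    {x y : E N} (hΔ : ∀ x, delta Ω x ≤ Δ) (ha0 : 0 < a) (ha : a ≤ p * s) (hxy : 0 < ‖y - x‖) :
    gagliardoDensity s p (fun x => delta Ω x ^ s) x y ≤ Δ ^ a * ‖y - x‖ ^ (-a - N) := by
  have hx := delta_nonneg Ω x
  have hy := delta_nonneg Ω y
  have hΔ0 : 0 ≤ Δ := hx.trans (hΔ x)
  have hpsa : 0 ≤ p * s - a := by linarith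
  have hdiff_le : |delta Ω x - delta Ω y| ≤ Δ := abs_sub_le_of_nonneg_of_le hx (hΔ x) hy (hΔ y)
  have hlip : |delta Ω x - delta Ω y| ≤ ‖y - x‖ := by
    rw [norm_sub_rev]
    exact abs_delta_sub_le Ω x y
  rw [gagliardoDensity, norm_sub_rev x y]
  calc |delta Ω x ^ s - delta Ω y ^ s| ^ p / ‖y - x‖ ^ ((N : ℝ) + p * s)
    _ ≤ (|delta Ω x - delta Ω y| ^ s) ^ p / ‖y - x‖ ^ ((N : ℝ) + p * s) := by
        gcongr
        exact abs_rpow_sub_rpow_le hs0 hs1 hx hy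
    _ = |delta Ω x - delta Ω y| ^ a * |delta Ω x - delta Ω y| ^ (p * s - a) /
          ‖y - x‖ ^ ((N : ℝ) + p * s) := by
        rw [← Real.rpow_mul (abs_nonneg _), ← Real.rpow_add_of_nonneg (abs_nonneg _) ha0.le hpsa]
        congr 2
        ring
    _ ≤ Δ ^ a * ‖y - x‖ ^ (p * s - a) / ‖y - x‖ ^ ((N : ℝ) + p * s) := by gcongr
    _ = Δ ^ a * ‖y - x‖ ^ (-a - N) := by
        rw [mul_div_assoc, ← Real.rpow_sub hxy]
        congr 2
        ring

lemma lintegral_gagliardoDensity_delta_rpow_far {Δ a : ℝ} (hN : 0 < N) (hs0 : 0 < s) (hs1 : s < 1)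
    (hp : 1 < p) {x : E N} (hd : 0 < delta Ω x) (hΔ : ∀ x, delta Ω x ≤ Δ) (ha0 : 0 < a)
    (ha : a ≤ p * s) :
    ∫⁻ y in (ball x (delta Ω x / 2))ᶜ,
        ENNReal.ofReal (gagliardoDensity s p (fun x => delta Ω x ^ s) x y) ≤
      ENNReal.ofReal (Δ ^ a * sphereArea (E N) * (2 ^ a / a)) *
        ENNReal.ofReal (delta Ω x ^ (-a)) := by
  have : 0 < Δ := hd.trans_le (hΔ x)
  obtain ⟨hint, hval⟩ := integrableOn_and_integral_norm_sub_rpow_compl_ball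
    (finrank_euclideanSpace_fin (𝕜 := ℝ)) hN ha0 (half_pos hd) x
  refine (setLIntegral_mono' measurableSet_ball.compl fun y hy => ENNReal.ofReal_le_ofReal
    (gagliardoDensity_delta_rpow_le_far hs0 hs1 hp hΔ ha0 ha ?_)).trans ?_
  · rw [mem_compl_iff, mem_ball_iff_norm, not_lt] at hy
    exact (half_pos hd).trans_le hy
  rw [← ofReal_integral_eq_lintegral_ofReal (hint.const_mul _)
    (Eventually.of_forall fun y => by positivity), integral_const_mul, hval,
    ← ENNReal.ofReal_mul' (by positivity)]
  refine ENNReal.ofReal_le_ofReal (le_of_eq ?_)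
  rw [Real.div_rpow hd.le two_pos.le, Real.rpow_neg two_pos.le, div_inv_eq_mul]
  ring

lemma TwoBall.lintegral_gagliardoDensity_delta_rpow_lt_top (hT : TwoBall R Ω) (hN : 0 < N)
    (hs0 : 0 < s) (hs1 : s < 1) (hp : 1 < p) (hR : 0 < R) (ho : IsOpen Ω)
    (hb : Bornology.IsBounded Ω) :
    ∫⁻ x in Ω, ∫⁻ y, ENNReal.ofReal (gagliardoDensity s p (fun x => delta Ω x ^ s) x y) < ∞ := by
  obtain ⟨Δ, hΔ⟩ := exists_delta_le hN hb
  set a : ℝ := min (1 / 2) (p * s)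
  have ha0 : 0 < a := by positivity
  have ha1 : a < 1 := (min_le_left _ _).trans_lt (by norm_num)
  have hinner (x) (hx : x ∈ Ω) :
      ∫⁻ y, ENNReal.ofReal (gagliardoDensity s p (fun x => delta Ω x ^ s) x y) ≤
        ENNReal.ofReal (sphereArea (E N) * (1 / (p * (1 - s)))) +
          ENNReal.ofReal (Δ ^ a * sphereArea (E N) * (2 ^ a / a)) *
            ENNReal.ofReal (delta Ω x ^ (-a)) := by
    have hd := delta_pos ho (nonempty_compl_of_isBounded hN hb) hx
    rw [← lintegral_add_compl _ (measurableSet_ball (x := x) (ε := delta Ω x / 2))]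
    exact add_le_add (lintegral_gagliardoDensity_delta_rpow_near hN hs0 hs1 hp hd)
      (lintegral_gagliardoDensity_delta_rpow_far hN hs0 hs1 hp hd hΔ ha0 (min_le_right _ _))
  refine (setLIntegral_mono' ho.measurableSet hinner).trans_lt ?_
  rw [lintegral_add_left measurable_const, setLIntegral_const,
    lintegral_const_mul' _ _ ENNReal.ofReal_ne_top]
  exact ENNReal.add_lt_top.2 ⟨ENNReal.mul_lt_top ENNReal.ofReal_lt_top hb.measure_lt_top,
    ENNReal.mul_lt_top ENNReal.ofReal_lt_top
      (hT.lintegral_delta_rpow_lt_top hN hR ho hb ha0 ha1)⟩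

lemma gagliardo_univ_lt_top (hp : 0 < p) (hΩ : MeasurableSet Ω) (hu : AEStronglyMeasurable u)
    (hu0 : ∀ x ∉ Ω, u x = 0)
    (hfin : ∫⁻ x in Ω, ∫⁻ y, ENNReal.ofReal (gagliardoDensity s p u x y) < ∞) :
    gagliardo s p univ u < ∞ := by
  have hinner (x) (hx : x ∈ Ωᶜ) : ∫⁻ y, ENNReal.ofReal (gagliardoDensity s p u x y) =
      ∫⁻ y in Ω, ENNReal.ofReal (gagliardoDensity s p u x y) := by
    have hout : ∫⁻ y in Ωᶜ, ENNReal.ofReal (gagliardoDensity s p u x y) = 0 := by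
      refine (setLIntegral_congr_fun hΩ.compl fun y hy => ?_).trans lintegral_zero
      rw [gagliardoDensity, hu0 x hx, hu0 y hy, sub_self, abs_zero, Real.zero_rpow hp.ne',
        zero_div, ENNReal.ofReal_zero]
    rw [← lintegral_add_compl _ hΩ, hout, add_zero]
  have houter : ∫⁻ x in Ωᶜ, ∫⁻ y, ENNReal.ofReal (gagliardoDensity s p u x y) ≤
      ∫⁻ y in Ω, ∫⁻ x, ENNReal.ofReal (gagliardoDensity s p u y x) := by
    rw [setLIntegral_congr_fun hΩ.compl hinner, lintegral_lintegral_swap]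
    · refine lintegral_mono fun y => (setLIntegral_le_lintegral _ _).trans_eq ?_
      simp_rw [gagliardoDensity_swap u y]
    · rw [Measure.prod_restrict]
      exact (aemeasurable_gagliardoDensity hu).ennreal_ofReal.restrict
  rw [gagliardo_univ_eq hu, ← lintegral_add_compl _ hΩ]
  exact ENNReal.add_lt_top.2 ⟨hfin, houter.trans_lt hfin⟩

lemma memLp_of_bound_of_eq_zero {C : ℝ} {q : ℝ≥0∞} (hΩ : MeasurableSet Ω) (hvol : volume Ω ≠ ∞)
    (hu : AEStronglyMeasurable u) (hC : ∀ x, ‖u x‖ ≤ C) (hu0 : ∀ x ∉ Ω, u x = 0) :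
    MemLp u q volume := by
  have : IsFiniteMeasure (volume.restrict Ω) := isFiniteMeasure_restrict.2 hvol
  have hmem : MemLp u q (volume.restrict Ω) :=
    MemLp.of_bound hu.restrict C (Eventually.of_forall hC)
  rw [← memLp_indicator_iff_restrict hΩ] at hmem
  rwa [indicator_eq_self.2 fun x hx => by_contra fun h => hx (hu0 x h)] at hmem

lemma memWtilde_of_bound_of_eq_zero {C : ℝ} (hq : 0 ≤ N + p * s) (hp : 1 < p)
    (hΩ : MeasurableSet Ω) (hvol : volume Ω ≠ ∞) (hu : AEStronglyMeasurable u)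
    (hC : ∀ x, ‖u x‖ ≤ C) (hu0 : ∀ x ∉ Ω, u x = 0) (hfin : gagliardo s p univ u < ∞)
    (U : Set (E N)) : MemWtilde s p U u := by
  refine ⟨fun K _ => (memLp_of_bound_of_eq_zero hΩ hvol hu hC hu0).restrict K,
    ⟨univ, isOpen_univ, subset_univ _,
      (memLp_of_bound_of_eq_zero hΩ hvol hu hC hu0).restrict _, hfin⟩, ?_⟩
  have htail (x) : ENNReal.ofReal (|u x| ^ (p - 1) / (1 + ‖x‖) ^ ((N : ℝ) + p * s)) ≤
      Ω.indicator (fun _ => ENNReal.ofReal (C ^ (p - 1))) x := by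
    by_cases hx : x ∈ Ω
    · rw [indicator_of_mem hx]
      refine ENNReal.ofReal_le_ofReal ((div_le_self (by positivity) ?_).trans ?_)
      · exact Real.one_le_rpow (by linarith [norm_nonneg x]) hq
      · exact Real.rpow_le_rpow (abs_nonneg _) (hC x) (by linarith)
    · rw [indicator_of_notMem hx, hu0 x hx, abs_zero, Real.zero_rpow (by linarith), zero_div,
        ENNReal.ofReal_zero]
  refine (lintegral_mono htail).trans_lt ?_
  rw [lintegral_indicator hΩ, setLIntegral_const]
  exact ENNReal.mul_lt_top ENNReal.ofReal_lt_top hvol.lt_top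

lemma aestronglyMeasurable_delta_rpow (Ω : Set (E N)) (s : ℝ) :
    AEStronglyMeasurable fun x : E N => delta Ω x ^ s :=
  ((continuous_delta Ω).measurable.pow_const s).aestronglyMeasurable

lemma delta_rpow_eq_zero (hs0 : 0 < s) {x : E N} (hx : x ∉ Ω) : delta Ω x ^ s = 0 := by
  rw [delta_eq_zero hx, Real.zero_rpow hs0.ne']

lemma TwoBall.gagliardo_delta_rpow_lt_top (hT : TwoBall R Ω) (hN : 0 < N) (hs0 : 0 < s)
    (hs1 : s < 1) (hp : 1 < p) (hR : 0 < R) (ho : IsOpen Ω) (hb : Bornology.IsBounded Ω) :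
    gagliardo s p univ (fun x => delta Ω x ^ s) < ∞ :=
  gagliardo_univ_lt_top (by linarith) ho.measurableSet (aestronglyMeasurable_delta_rpow Ω s)
    (fun _ => delta_rpow_eq_zero hs0)
    (hT.lintegral_gagliardoDensity_delta_rpow_lt_top hN hs0 hs1 hp hR ho hb)

lemma TwoBall.memWtilde_delta_rpow (hT : TwoBall R Ω) (hN : 0 < N) (hs0 : 0 < s)
    (hs1 : s < 1) (hp : 1 < p) (hR : 0 < R) (ho : IsOpen Ω) (hb : Bornology.IsBounded Ω)
    (U : Set (E N)) : MemWtilde s p U (fun x => delta Ω x ^ s) := by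
  obtain ⟨Δ, hΔ⟩ := exists_delta_le hN hb
  have hbound (x) : ‖delta Ω x ^ s‖ ≤ Δ ^ s := by
    rw [Real.norm_of_nonneg (Real.rpow_nonneg (delta_nonneg _ _) _)]
    exact Real.rpow_le_rpow (delta_nonneg _ _) (hΔ x) hs0.le
  exact memWtilde_of_bound_of_eq_zero (by positivity) hp ho.measurableSet hb.measure_lt_top.ne
    (aestronglyMeasurable_delta_rpow Ω s) hbound (fun _ => delta_rpow_eq_zero hs0)
    (hT.gagliardo_delta_rpow_lt_top hN hs0 hs1 hp hR ho hb) U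

end Energy

section WeakForm

variable {N : ℕ} {Ω U : Set (E N)} {R s p κ : ℝ} {u φ : E N → ℝ} {x : E N}

lemma integrable_gagliardoDensity (hu : AEStronglyMeasurable u)
    (hfin : gagliardo s p univ u < ∞) :
    Integrable fun z : E N × E N => gagliardoDensity s p u z.1 z.2 := by
  refine ⟨(aemeasurable_gagliardoDensity hu).aestronglyMeasurable, ?_⟩
  rw [hasFiniteIntegral_iff_ofReal (Eventually.of_forall fun z => gagliardoDensity_nonneg _ _ _)]
  rwa [gagliardo, univ_prod_univ, Measure.restrict_univ] at hfin

lemma rpow_mul_le_rpow_add_rpow (hp : 1 < p) {a b : ℝ} (ha : 0 ≤ a) (hb : 0 ≤ b) :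
    a ^ (p - 1) * b ≤ a ^ p + b ^ p := by
  have : 0 ≤ p - 1 := by linarith
  have hpow {t : ℝ} (ht : 0 ≤ t) : t ^ (p - 1) * t = t ^ p := by
    rw [← Real.rpow_add_one' ht (by linarith), sub_add_cancel]
  rcases le_total a b with hab | hba
  · calc a ^ (p - 1) * b ≤ b ^ (p - 1) * b := by gcongr
      _ = b ^ p := hpow hb
      _ ≤ a ^ p + b ^ p := le_add_of_nonneg_left (by positivity)
  · calc a ^ (p - 1) * b ≤ a ^ (p - 1) * a := by gcongr
      _ = a ^ p := hpow ha
      _ ≤ a ^ p + b ^ p := le_add_of_nonneg_right (by positivity)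

lemma norm_weakIntegrand_le (hp : 1 < p) (u φ : E N → ℝ) (z : E N × E N) :
    ‖weakIntegrand s p u φ z‖ ≤
      gagliardoDensity s p u z.1 z.2 + gagliardoDensity s p φ z.1 z.2 := by
  rw [weakIntegrand, norm_div, norm_mul, Real.norm_eq_abs, Real.norm_eq_abs,
    abs_spow (by linarith), Real.norm_of_nonneg (by positivity), gagliardoDensity,
    gagliardoDensity, ← add_div]
  gcongr
  exact rpow_mul_le_rpow_add_rpow hp (abs_nonneg _) (abs_nonneg _)

lemma integrable_weakIntegrand (hp : 1 < p) (hu : AEStronglyMeasurable u)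
    (hφ : AEStronglyMeasurable φ) (hufin : gagliardo s p univ u < ∞)
    (hφfin : gagliardo s p univ φ < ∞) : Integrable (weakIntegrand s p u φ) := by
  have hsub {v : E N → ℝ} (hv : AEStronglyMeasurable v) :
      AEMeasurable fun z : E N × E N => v z.1 - v z.2 :=
    hv.aemeasurable.comp_fst.sub hv.aemeasurable.comp_snd
  have hmeas : AEMeasurable (weakIntegrand s p u φ) :=
    (((measurable_spow (p - 1)).comp_aemeasurable (hsub hu)).mul (hsub hφ)).div (by fun_prop)
  exact ((integrable_gagliardoDensity hu hufin).add (integrable_gagliardoDensity hφ hφfin)).mono'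
    hmeas.aestronglyMeasurable (Eventually.of_forall (norm_weakIntegrand_le hp u φ))

lemma integral_mul_sub_of_antisymm {α : Type*} [MeasureSpace α] [SFinite (volume : Measure α)]
    {K : α × α → ℝ} {φ : α → ℝ} (hK : ∀ z, K z.swap = -K z)
    (hint : Integrable fun z : α × α => K z * φ z.1) :
    ∫ z : α × α, K z * (φ z.1 - φ z.2) = 2 * ∫ x, (∫ y, K (x, y)) * φ x := by
  set A : α × α → ℝ := fun z => K z * φ z.1 with hA
  rw [Measure.volume_eq_prod] at hint ⊢
  have hsplit (z : α × α) : K z * (φ z.1 - φ z.2) = A z + A z.swap := by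
    rw [hA]
    simp only [hK, Prod.fst_swap]
    ring
  calc ∫ z, K z * (φ z.1 - φ z.2) ∂volume.prod volume
    _ = ∫ z, A z ∂volume.prod volume + ∫ z, A z.swap ∂volume.prod volume := by
        simp_rw [hsplit]
        exact integral_add hint hint.swap
    _ = 2 * ∫ z, A z ∂volume.prod volume := by rw [integral_prod_swap A, two_mul]
    _ = 2 * ∫ x, (∫ y, K (x, y)) * φ x := by
        rw [integral_prod _ hint]
        simp only [hA, integral_mul_const]

lemma integrable_profile_delta_mul_fst (hN : 0 < N) (hs0 : 0 < s) (hs1 : s < 1) (hp : 1 < p)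
    (hκ0 : 0 < κ) (hκ1 : κ < 1) (hUm : MeasurableSet U) (hd : ∀ x ∈ U, 0 < delta Ω x)
    (hφm : AEStronglyMeasurable φ) (hφ0 : ∀ᵐ x, x ∉ U → φ x = 0)
    (hφi : IntegrableOn (fun x => delta Ω x ^ (-s) * |φ x|) U) :
    Integrable fun z : E N × E N => profile s p κ (delta Ω z.1) (delta Ω z.2) /
      ‖z.1 - z.2‖ ^ ((N : ℝ) + p * s) * φ z.1 := by
  have hmeas : AEStronglyMeasurable (fun z : E N × E N => profile s p κ (delta Ω z.1)
      (delta Ω z.2) / ‖z.1 - z.2‖ ^ ((N : ℝ) + p * s) * φ z.1) (volume.prod volume) :=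
    (measurable_profile_delta Ω).aestronglyMeasurable.mul hφm.comp_fst
  have hK (x) (hx : x ∈ U) := integrable_profile_delta hN hs0 hs1 hp hκ0 hκ1 (hd x hx)
  rw [Measure.volume_eq_prod, integrable_prod_iff hmeas]
  constructor
  · filter_upwards [hφ0] with x hx
    by_cases hxU : x ∈ U
    · exact (hK x hxU).1.mul_const (φ x)
    · simp only [hx hxU, mul_zero]
      exact integrable_zero _ _ _
  · have hdom := ((integrable_indicator_iff hUm).2 hφi).const_mul
      (sphereArea (E N) * ((1 - κ) ^ (-s) / s))
    refine hdom.mono' hmeas.norm.integral_prod_right' ?_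
    filter_upwards [hφ0] with x hx
    rw [Real.norm_of_nonneg (integral_nonneg fun y => norm_nonneg _)]
    by_cases hxU : x ∈ U
    · rw [indicator_of_mem hxU]
      simp only [norm_mul]
      rw [integral_mul_const, Real.norm_eq_abs, ← mul_assoc]
      refine mul_le_mul_of_nonneg_right ((hK x hxU).2.trans_eq ?_) (abs_nonneg _)
      rw [Real.mul_rpow (by linarith) (hd x hxU).le]
      ring
    · simp only [indicator_of_notMem hxU, hx hxU, mul_zero, norm_zero, integral_zero, le_refl]

lemma integral_profile_delta_mul_sub (hN : 0 < N) (hs0 : 0 < s) (hs1 : s < 1) (hp : 1 < p)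
    (hκ0 : 0 < κ) (hκ1 : κ < 1) (hUm : MeasurableSet U) (hd : ∀ x ∈ U, 0 < delta Ω x)
    (hφm : AEStronglyMeasurable φ) (hφ0 : ∀ᵐ x, x ∉ U → φ x = 0)
    (hφi : IntegrableOn (fun x => delta Ω x ^ (-s) * |φ x|) U) :
    ∫ z : E N × E N, profile s p κ (delta Ω z.1) (delta Ω z.2) / ‖z.1 - z.2‖ ^ ((N : ℝ) + p * s) *
      (φ z.1 - φ z.2) = ∫ x in U, 2 * truncOp s p κ Ω x * φ x := by
  rw [integral_mul_sub_of_antisymm (fun z => ?_)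
    (integrable_profile_delta_mul_fst hN hs0 hs1 hp hκ0 hκ1 hUm hd hφm hφ0 hφi)]
  · simp_rw [mul_assoc]
    rw [integral_const_mul, setIntegral_eq_integral_of_ae_compl_eq_zero]
    · rfl
    · filter_upwards [hφ0] with x hx hxU
      rw [hx hxU, mul_zero]
  · rw [Prod.fst_swap, Prod.snd_swap, profile_swap, norm_sub_rev, neg_div]

lemma tendsto_integral_profile_delta_mul_sub {κ : ℕ → ℝ} (hκ : Tendsto κ atTop (𝓝 1))
    (hφm : AEStronglyMeasurable φ)
    (hint : Integrable (weakIntegrand s p (fun x => delta Ω x ^ s) φ)) :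
    Tendsto (fun k => ∫ z : E N × E N, profile s p (κ k) (delta Ω z.1) (delta Ω z.2) /
        ‖z.1 - z.2‖ ^ ((N : ℝ) + p * s) * (φ z.1 - φ z.2)) atTop
      (𝓝 (∫ z, weakIntegrand s p (fun x => delta Ω x ^ s) φ z)) := by
  refine tendsto_integral_of_dominated_convergence _ (fun k => ?_) hint.norm
    (fun k => Eventually.of_forall fun z => ?_) (Eventually.of_forall fun z => ?_)
  · exact (measurable_profile_delta Ω).aestronglyMeasurable.mul
      ((AEStronglyMeasurable.comp_fst hφm).sub (AEStronglyMeasurable.comp_snd hφm))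
  · rw [weakIntegrand, div_mul_eq_mul_div, norm_div, norm_div, norm_mul, norm_mul]
    gcongr
    exact abs_profile_le_abs_spow _ _
  · rw [weakIntegrand, mul_div_right_comm]
    exact ((tendsto_profile _ _ hκ).div_const _).mul_const _

lemma isOpen_nearBoundary (ho : IsOpen Ω) (ρ : ℝ) : IsOpen (nearBoundary Ω ρ) :=
  ho.inter ((continuous_delta Ω).isOpen_preimage _ isOpen_Iio)

lemma TwoBall.exists_isTubularNormal_of_mem_nearBoundary (hT : TwoBall R Ω) (hN : 0 < N)
    (ho : IsOpen Ω) (hb : Bornology.IsBounded Ω) (hx : x ∈ nearBoundary Ω (R / 24)) :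
    0 < delta Ω x ∧ ∃ n, IsTubularNormal Ω R x n := by
  have hne := nonempty_compl_of_isBounded hN hb
  have hd := delta_pos ho hne hx.1
  have hR : 0 < R := by linarith [hd.trans hx.2]
  refine ⟨hd, hT.exists_isTubularNormal hR ⟨x, hx.1⟩ hne ?_⟩
  rw [sdist_eq_delta hx.1, abs_of_pos hd]
  exact hx.2

lemma TwoBall.exists_memLp_tendsto_truncOp (hT : TwoBall R Ω) (hN : 0 < N) (hs0 : 0 < s)
    (hs1 : s < 1) (hp : 1 < p) {κ : ℕ → ℝ} (hκ0 : ∀ k, 0 < κ k) (hκ1 : ∀ k, κ k < 1)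
    (hκ : Tendsto κ atTop (𝓝 1)) (ho : IsOpen Ω) (hb : Bornology.IsBounded Ω) :
    ∃ f : E N → ℝ, MemLp f ∞ (volume.restrict (nearBoundary Ω (R / 24))) ∧
      ∀ x ∈ nearBoundary Ω (R / 24),
        Tendsto (fun k => 2 * truncOp s p (κ k) Ω x) atTop (𝓝 (f x)) := by
  have hlim (x) (hx : x ∈ nearBoundary Ω (R / 24)) : ∃ L, |L| ≤ 2 * errorConst N s p R ∧
      Tendsto (fun k => 2 * truncOp s p (κ k) Ω x) atTop (𝓝 L) := by
    obtain ⟨hd, n, hn⟩ := hT.exists_isTubularNormal_of_mem_nearBoundary hN ho hb hx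
    obtain ⟨L, hL, hlim⟩ := exists_tendsto_truncOp hN hs0 hs1 hp hκ0 hκ1 hκ hd hn
    refine ⟨2 * L, ?_, hlim.const_mul 2⟩
    rw [abs_mul, abs_two]
    gcongr
  choose! f hf_le hf using hlim
  have hUm := (isOpen_nearBoundary ho (R / 24)).measurableSet
  refine ⟨f, memLp_top_of_bound ?_ _ (ae_restrict_of_forall_mem hUm hf_le), hf⟩
  exact aestronglyMeasurable_of_tendsto_ae atTop
    (fun k => ((stronglyMeasurable_truncOp Ω).const_mul 2).aestronglyMeasurable)
    (ae_restrict_of_forall_mem hUm hf)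

lemma TwoBall.tendsto_setIntegral_truncOp_mul (hT : TwoBall R Ω) (hN : 0 < N) (hs0 : 0 < s)
    (hs1 : s < 1) (hp : 1 < p) {κ : ℕ → ℝ} (hκ0 : ∀ k, 0 < κ k) (hκ1 : ∀ k, κ k < 1)
    (ho : IsOpen Ω) (hb : Bornology.IsBounded Ω) {f : E N → ℝ}
    (hf : ∀ x ∈ nearBoundary Ω (R / 24),
      Tendsto (fun k => 2 * truncOp s p (κ k) Ω x) atTop (𝓝 (f x)))
    (hφ : IntegrableOn φ (nearBoundary Ω (R / 24)))
    (hδφ : IntegrableOn (fun x => delta Ω x ^ (-s) * |φ x|) (nearBoundary Ω (R / 24))) :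
    Tendsto (fun k => ∫ x in nearBoundary Ω (R / 24), 2 * truncOp s p (κ k) Ω x * φ x) atTop
      (𝓝 (∫ x in nearBoundary Ω (R / 24), f x * φ x)) := by
  have hUm := (isOpen_nearBoundary ho (R / 24)).measurableSet
  set C := errorConst N s p R
  set C' := layerConst (N - 1) (N + p * s) / (p * s)
  refine tendsto_integral_of_dominated_convergence
    (fun x => 2 * C * ‖φ x‖ + 2 * C' * (delta Ω x ^ (-s) * |φ x|)) (fun k => ?_)
    ((hφ.norm.const_mul _).add (hδφ.const_mul _)) (fun k => ?_) ?_
  · exact ((stronglyMeasurable_truncOp Ω).const_mul 2).aestronglyMeasurable.mul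
      hφ.aestronglyMeasurable
  · refine ae_restrict_of_forall_mem hUm fun x hx => ?_
    obtain ⟨hd, n, hn⟩ := hT.exists_isTubularNormal_of_mem_nearBoundary hN ho hb hx
    rw [norm_mul, norm_mul, Real.norm_two, Real.norm_eq_abs, Real.norm_eq_abs]
    calc 2 * |truncOp s p (κ k) Ω x| * |φ x|
      _ ≤ 2 * (C + C' * delta Ω x ^ (-s)) * |φ x| := by
          gcongr
          exact abs_truncOp_le hN hs0 hs1 hp (hκ0 k) (hκ1 k) hd hn
      _ = 2 * C * |φ x| + 2 * C' * (delta Ω x ^ (-s) * |φ x|) := by ring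
  · exact ae_restrict_of_forall_mem hUm fun x hx => (hf x hx).mul_const _

lemma MemW0.integrableOn (hφ : MemW0 s p U φ) (hp : 1 ≤ p) (hU : volume U ≠ ∞) :
    IntegrableOn φ U := by
  have : IsFiniteMeasure (volume.restrict U) := isFiniteMeasure_restrict.2 hU
  have hLp := hφ.1.1
  rw [Measure.restrict_univ] at hLp
  exact (hLp.restrict U).integrable (ENNReal.one_le_ofReal.2 hp)

end WeakForm

end FracPLap

end

open FracPLap Filter in
theorem theorem3p6_general (N : ℕ) (hN : 0 < N) (s p R : ℝ) (hs0 : 0 < s) (hs1 : s < 1)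
    (hp : 1 < p) (hR : 0 < R) (Ω : Set (E N)) (hΩo : IsOpen Ω) (hΩb : Bornology.IsBounded Ω)
    (hT : TwoBall R Ω) :
    ∃ f : E N → ℝ, MemLp f ∞ (volume.restrict (nearBoundary Ω (R / 24))) ∧
      IsWeakSolution s p (nearBoundary Ω (R / 24)) (fun x => delta Ω x ^ s) f := by
  obtain ⟨κ, -, hκ01, hκ⟩ := exists_seq_strictMono_tendsto' (zero_lt_one' ℝ)
  have hκ0 (k) : 0 < κ k := (hκ01 k).1
  have hκ1 (k) : κ k < 1 := (hκ01 k).2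
  obtain ⟨f, hf, hflim⟩ := hT.exists_memLp_tendsto_truncOp hN hs0 hs1 hp hκ0 hκ1 hκ hΩo hΩb
  set U := nearBoundary Ω (R / 24)
  have hUm : MeasurableSet U := (isOpen_nearBoundary hΩo _).measurableSet
  have hUΩ : U ⊆ Ω := fun x hx => hx.1
  have hδ (x) (hx : x ∈ U) : 0 < delta Ω x :=
    (hT.exists_isTubularNormal_of_mem_nearBoundary hN hΩo hΩb hx).1
  refine ⟨f, hf, hT.memWtilde_delta_rpow hN hs0 hs1 hp hR hΩo hΩb U, fun φ hφ => ?_⟩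
  have hφU : IntegrableOn φ U :=
    hφ.integrableOn hp.le (hΩb.subset hUΩ).measure_lt_top.ne
  have hδφ : IntegrableOn (fun x => delta Ω x ^ (-s) * |φ x|) U :=
    hT.integrableOn_delta_rpow_mul hN hs0 hp hΩo hΩb hUm hUΩ
      (fun x hx => hx.2.le.trans (by linarith)) hφ
  have hweak : Integrable (weakIntegrand s p (fun x => delta Ω x ^ s) φ) :=
    integrable_weakIntegrand hp (aestronglyMeasurable_delta_rpow Ω s) hφ.aestronglyMeasurable
      (hT.gagliardo_delta_rpow_lt_top hN hs0 hs1 hp hR hΩo hΩb) hφ.1.2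
  refine ⟨hweak, hφU.mul_of_top_right hf, ?_⟩
  refine tendsto_nhds_unique
    (tendsto_integral_profile_delta_mul_sub hκ hφ.aestronglyMeasurable hweak)
    ((hT.tendsto_setIntegral_truncOp_mul hN hs0 hs1 hp hκ0 hκ1 hΩo hΩb hflim hφU hδφ).congr
      fun k => ?_)
  exact (integral_profile_delta_mul_sub hN hs0 hs1 hp (hκ0 k) (hκ1 k) hUm hδ
    hφ.aestronglyMeasurable hφ.2 hδφ).symm

theorem theorem3p6 (N : ℕ) (hN : 1 < N) (s p : ℝ) (hs0 : 0 < s) (hs1 : s < 1) (hp : 1 < p)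
    (Ω : Set (FracPLap.E N)) (hΩo : IsOpen Ω) (hΩc : IsConnected Ω)
    (hΩb : Bornology.IsBounded Ω) (hΩ : FracPLap.HasC11Boundary Ω) :
    ∃ ρ : ℝ, 0 < ρ ∧ ∃ f : FracPLap.E N → ℝ,
      MemLp f ∞ (volume.restrict (FracPLap.nearBoundary Ω ρ)) ∧
      FracPLap.IsWeakSolution s p (FracPLap.nearBoundary Ω ρ)
        (fun x => FracPLap.delta Ω x ^ s) f := by
  obtain ⟨R, hR, hT⟩ := hΩ.exists_twoBall hΩo hΩb
  exact ⟨R / 24, by positivity,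
    theorem3p6_general N (by omega) s p R hs0 hs1 hp hR Ω hΩo hΩb hT⟩
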